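/- **Setting.** Let $M$ be a noncompact (Hausdorff, second countable) smooth manifold of real dimension $2n+1$ with an integrable CR structure, i.e. a smooth complex rank-$n$ subbundle $T_{1,0}\subset \mathbb C TM$ with $T_{1,0}\cap \overline{T_{1,0}}=0$ and $[T_{1,0},T_{1,0}]\subset T_{1,0}$; equivalently, a smooth real rank-$2n$ subbundle $G=\mathrm{Re}(T_{1,0}\oplus \overline{T_{1,0}})\subset TM$ with a complex structure $J:G\to G$ such that $T_{1,0}=\{V-iJV : V\in G\}$ is closed under brackets. Let $\theta$ be a smooth real 1-form with $\ker\theta=G$ whose Levi form $L_\theta(V,W)=d\theta(V,JW)$ is positive definite on $G$ (strict pseudoconvexity). Denote by $\langle\cdot,\cdot\rangle_\theta$ the inner product induced by $L_\theta$ on (restrictions to $G$ of) covectors, put $|\nabla_\theta u|^2=\langle du,du\rangle_\theta$ and $dV_\theta=\theta\wedge(d\theta)^n$, and let $\Delta_\theta u$, for $u\in C^2(M)$, be the continuous function with $$\int_M(\Delta_\theta u)\,\varphi\,dV_\theta=-\int_M\langle du,d\varphi\rangle_\theta\,dV_\theta\qquad\text{for all }\varphi\in C_c^\infty(M).$$ Assume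 that $(M,\theta)$ is complete, i.e. complete for its Carnot–Carathéodory distance, and that it satisfies *Condition A*: there are a constant $A$ and a smooth function $f:M\to(0,\infty)$ such that $f\to\infty$ near infinity (for every $K$ the set $\{f\le K\}$ is contained in a compact set) and $$|\nabla_\theta f|\le A,\qquad \Delta_\theta f\le A\qquad\text{on } M.$$ **Theorem 4.1 (weak maximum principle).** Let $T>0$ and $C>0$ be constants, let $F$ be a real function of a covector $p\in T_x^*M$ and of $(u,x,t)\in\mathbb R\times M\times[0,T]$, and let $u\in C^2(M\times[0,T])$ satisfy $$\frac{\partial u}{\partial t}=\Delta_\theta u+F(du,u,x,t)\quad\text{and}\quad |u|\le C\quad\text{on } M\times[0,T],\qquad u(x,0)\le 0\quad\text{on } M,$$ $$F(du,u,x,t)\le C\,u(x,t)\quad\text{at all }(x,t)\in M\times[0,T]\text{ with }u(x,t)>0,$$ where $du$ is the differential of $u(\cdot,t)$ at $x$ and the time derivative is one-sided at $t=0$ and $t=T$. Then $u\le 0$ on $M\times[0,T]$. -/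

import Mathlib

open scoped Manifold ContDiff Topology
open Set Filter MeasureTheory

noncomputable section

/-- The model space of a manifold of real dimension `2n + 1`. -/
abbrev CRModel (n : ℕ) : Type := EuclideanSpace ℝ (Fin (2 * n + 1))

/-- Tangent space of a `(2n+1)`-dimensional manifold. -/
abbrev CRTangent (n : ℕ) {M : Type*} [TopologicalSpace M] [ChartedSpace (CRModel n) M]
    (x : M) : Type := TangentSpace 𝓘(ℝ, CRModel n) x

/-- The differential `du` of a real function at a point, a covector. -/
def differential (n : ℕ) {M : Type*} [TopologicalSpace M] [ChartedSpace (CRModel n) M]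
    (u : M → ℝ) (x : M) : CRTangent n x →L[ℝ] ℝ :=
  mfderiv 𝓘(ℝ, CRModel n) 𝓘(ℝ, ℝ) u x

/-- A vector field, given by arbitrary values on `M`, is smooth on the set `U`. -/
def IsSmoothVectorFieldOn (n : ℕ) {M : Type*} [TopologicalSpace M] [ChartedSpace (CRModel n) M]
    [IsManifold 𝓘(ℝ, CRModel n) ∞ M] (V : ∀ x : M, CRTangent n x) (U : Set M) : Prop :=
  ContMDiffOn 𝓘(ℝ, CRModel n) 𝓘(ℝ, CRModel n).tangent ∞
    (fun x => (⟨x, V x⟩ : TangentBundle 𝓘(ℝ, CRModel n) M)) U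

/-- Pull-back `(e⁻¹)^* θ` of a 1-form to the target of a chart `e`. -/
def chartForm {n : ℕ} {M : Type*} [TopologicalSpace M] [ChartedSpace (CRModel n) M]
    (θ : ∀ x : M, CRTangent n x →L[ℝ] ℝ) (e : OpenPartialHomeomorph M (CRModel n))
    (y : CRModel n) : CRModel n →L[ℝ] ℝ :=
  (θ (e.symm y)).comp (mfderiv 𝓘(ℝ, CRModel n) 𝓘(ℝ, CRModel n) e.symm y)

/-- A 1-form is smooth if its coefficients are smooth in every chart of the atlas. -/
def IsSmoothOneForm {n : ℕ} {M : Type*} [TopologicalSpace M] [ChartedSpace (CRModel n) M]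
    (θ : ∀ x : M, CRTangent n x →L[ℝ] ℝ) : Prop :=
  ∀ e ∈ atlas (CRModel n) M, ContDiffOn ℝ ∞ (chartForm θ e) e.target

/-- The differential at `x` of the preferred chart at `x`. -/
def chartDifferential (n : ℕ) {M : Type*} [TopologicalSpace M] [ChartedSpace (CRModel n) M]
    (x : M) : CRTangent n x →L[ℝ] CRModel n :=
  mfderiv 𝓘(ℝ, CRModel n) 𝓘(ℝ, CRModel n) (chartAt (CRModel n) x) x

/-- The exterior derivative `dθ` of a 1-form at `x`, computed in the preferred chart at `x`:
`dθ(v, w) = (D_v θ)(w) - (D_w θ)(v)`. For smooth `θ` it does not depend on the chart. -/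
def oneFormExtDeriv {n : ℕ} {M : Type*} [TopologicalSpace M] [ChartedSpace (CRModel n) M]
    (θ : ∀ x : M, CRTangent n x →L[ℝ] ℝ) (x : M) (v w : CRTangent n x) : ℝ :=
  fderiv ℝ (chartForm θ (chartAt (CRModel n) x)) (chartAt (CRModel n) x x)
      (chartDifferential n x v) (chartDifferential n x w) -
    fderiv ℝ (chartForm θ (chartAt (CRModel n) x)) (chartAt (CRModel n) x x)
      (chartDifferential n x w) (chartDifferential n x v)

/-- An (integrable) CR structure on a `(2n+1)`-dimensional manifold: a smooth real rank-`2n`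
subbundle `G` of `TM` with a smooth complex structure `J`. The complex bundle `T_{1,0}` consists
of the vectors `v - i J v` with `v ∈ G`. The field `frame` provides smooth local frames
`Z_a = X_a - i Y_a` of `T_{1,0}`; the field `integrable` says `[T_{1,0}, T_{1,0}] ⊆ T_{1,0}`, where
`[V - i V', W - i W'] = ([V, W] - [V', W']) - i ([V, W'] + [V', W])`. -/
structure CRStructure (n : ℕ) (M : Type*) [TopologicalSpace M] [ChartedSpace (CRModel n) M]
    [IsManifold 𝓘(ℝ, CRModel n) ∞ M] where
  G : ∀ x : M, Submodule ℝ (CRTangent n x)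
  J : ∀ x : M, G x →ₗ[ℝ] G x
  J_sq : ∀ (x : M) (v : G x), J x (J x v) = -v
  frame : ∀ x₀ : M, ∃ (U : Set M) (X Y : Fin n → ∀ x : M, CRTangent n x),
    IsOpen U ∧ x₀ ∈ U ∧
    (∀ a, IsSmoothVectorFieldOn n (X a) U) ∧ (∀ a, IsSmoothVectorFieldOn n (Y a) U) ∧
    ∀ x ∈ U,
      (∀ a, ∃ h : X a x ∈ G x, Y a x = J x ⟨X a x, h⟩) ∧
      LinearIndependent ℝ (Sum.elim (fun a => X a x) (fun a => Y a x)) ∧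
      Submodule.span ℝ (Set.range (Sum.elim (fun a => X a x) (fun a => Y a x))) = G x
  integrable : ∀ (U : Set M) (V V' W W' : ∀ x : M, CRTangent n x), IsOpen U →
    IsSmoothVectorFieldOn n V U → IsSmoothVectorFieldOn n V' U →
    IsSmoothVectorFieldOn n W U → IsSmoothVectorFieldOn n W' U →
    (∀ x ∈ U, ∃ h : V x ∈ G x, V' x = J x ⟨V x, h⟩) →
    (∀ x ∈ U, ∃ h : W x ∈ G x, W' x = J x ⟨W x, h⟩) →
    ∀ x ∈ U, ∃ h : VectorField.mlieBracket 𝓘(ℝ, CRModel n) V W x -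
          VectorField.mlieBracket 𝓘(ℝ, CRModel n) V' W' x ∈ G x,
      VectorField.mlieBracket 𝓘(ℝ, CRModel n) V W' x +
          VectorField.mlieBracket 𝓘(ℝ, CRModel n) V' W x =
        J x ⟨VectorField.mlieBracket 𝓘(ℝ, CRModel n) V W x -
          VectorField.mlieBracket 𝓘(ℝ, CRModel n) V' W' x, h⟩

/-- A strictly pseudoconvex CR manifold `(M, θ)`: a CR structure with a contact form `θ`, that is,
a smooth 1-form with kernel `G` (hence nowhere zero, `G` having rank `2n`) whose Levi form
`L_θ(V, W) = dθ(V, J W)` is positive definite on `G`. -/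
structure PseudohermitianStructure (n : ℕ) (M : Type*) [TopologicalSpace M]
    [ChartedSpace (CRModel n) M] [IsManifold 𝓘(ℝ, CRModel n) ∞ M] extends CRStructure n M where
  θ : ∀ x : M, CRTangent n x →L[ℝ] ℝ
  θ_smooth : IsSmoothOneForm θ
  mem_G_iff : ∀ (x : M) (v : CRTangent n x), v ∈ G x ↔ θ x v = 0
  levi_pos : ∀ (x : M) (v : G x), v ≠ 0 → 0 < oneFormExtDeriv θ x v (J x v)

namespace PseudohermitianStructure

variable {n : ℕ} {M : Type*} [TopologicalSpace M] [ChartedSpace (CRModel n) M]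
  [IsManifold 𝓘(ℝ, CRModel n) ∞ M]

/-- The Levi form `L_θ(V, W) = dθ(V, J W)` on `G`. -/
def levi (P : PseudohermitianStructure n M) (x : M) : P.G x →ₗ[ℝ] P.G x →ₗ[ℝ] ℝ :=
  LinearMap.mk₂ ℝ (fun v w => oneFormExtDeriv P.θ x v (P.J x w))
    (by intro a b c; simp only [oneFormExtDeriv, Submodule.coe_add, map_add, _root_.add_apply]; ring)
    (by intro r a b; simp only [oneFormExtDeriv, Submodule.coe_smul, map_smul, _root_.smul_apply,
          smul_eq_mul]; ring)
    (by intro a b c; simp only [oneFormExtDeriv, Submodule.coe_add, map_add, _root_.add_apply]; ring)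
    (by intro r a b; simp only [oneFormExtDeriv, Submodule.coe_smul, map_smul, _root_.smul_apply,
          smul_eq_mul]; ring)

lemma levi_apply (P : PseudohermitianStructure n M) (x : M) (v w : P.G x) :
    P.levi x v w = oneFormExtDeriv P.θ x v (P.J x w) := rfl

instance finiteDimensional_G (P : PseudohermitianStructure n M) (x : M) :
    FiniteDimensional ℝ (P.G x) :=
  haveI : FiniteDimensional ℝ (CRTangent n x) :=
    inferInstanceAs (FiniteDimensional ℝ (CRModel n))
  inferInstance

lemma levi_injective (P : PseudohermitianStructure n M) (x : M) :
    Function.Injective (P.levi x) := by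
  refine (injective_iff_map_eq_zero _).2 fun v hv => ?_
  by_contra hne
  have h := P.levi_pos x v hne
  rw [← P.levi_apply, hv] at h
  simp at h

/-- The isomorphism `G → G^*` given by the Levi form, `v ↦ L_θ(v, ·)`. -/
def leviEquiv (P : PseudohermitianStructure n M) (x : M) : P.G x ≃ₗ[ℝ] Module.Dual ℝ (P.G x) :=
  LinearMap.linearEquivOfInjective (P.levi x) (P.levi_injective x)
    Subspace.dual_finrank_eq.symm

/-- The vector `α^♯ ∈ G` dual to a covector `α`: `L_θ(α^♯, w) = α(w)` for all `w ∈ G`.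
For `α = du` it is the horizontal gradient `∇_θ u`. -/
def sharp (P : PseudohermitianStructure n M) (x : M) (α : CRTangent n x →L[ℝ] ℝ) : P.G x :=
  (P.leviEquiv x).symm (α.toLinearMap.comp (P.G x).subtype)

lemma levi_sharp (P : PseudohermitianStructure n M) (x : M) (α : CRTangent n x →L[ℝ] ℝ)
    (w : P.G x) : P.levi x (P.sharp x α) w = α w := by
  have h := (P.leviEquiv x).apply_symm_apply (α.toLinearMap.comp (P.G x).subtype)
  exact congrArg (fun g : Module.Dual ℝ (P.G x) => g w) h

/-- The inner product `⟨α, β⟩_θ` of covectors induced by the Levi form. -/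
def coInner (P : PseudohermitianStructure n M) (x : M) (α β : CRTangent n x →L[ℝ] ℝ) : ℝ :=
  P.levi x (P.sharp x α) (P.sharp x β)

/-- The length `|∇_θ u| = ⟨du, du⟩_θ^{1/2}` of the horizontal gradient. -/
def gradNorm (P : PseudohermitianStructure n M) (u : M → ℝ) (x : M) : ℝ :=
  √(P.coInner x (differential n u x) (differential n u x))

/-- The volume form `θ ∧ (dθ)^n` evaluated on `2n + 1` tangent vectors. -/
def volumeForm (P : PseudohermitianStructure n M) (x : M)
    (v : Fin (2 * n + 1) → CRTangent n x) : ℝ :=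
  (1 / 2 ^ n : ℝ) * ∑ σ : Equiv.Perm (Fin (2 * n + 1)),
    ((Equiv.Perm.sign σ : ℤ) : ℝ) * P.θ x (v (σ ⟨0, by omega⟩)) *
      ∏ k : Fin n, oneFormExtDeriv P.θ x
        (v (σ ⟨2 * k.1 + 1, by omega⟩)) (v (σ ⟨2 * k.1 + 2, by omega⟩))

/-- The density `|θ ∧ (dθ)^n (∂_1, …, ∂_{2n+1})|` of `dV_θ` in the coordinates of a chart `e`. -/
def density (P : PseudohermitianStructure n M) (e : OpenPartialHomeomorph M (CRModel n))
    (y : CRModel n) : ℝ :=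
  |P.volumeForm (e.symm y) (fun i => mfderiv 𝓘(ℝ, CRModel n) 𝓘(ℝ, CRModel n) e.symm y
    (EuclideanSpace.single i (1 : ℝ) : CRModel n))|

/-- The integral `∫_M h dV_θ` of a function `h` that vanishes outside the domain of a chart `e`. -/
def chartIntegral (P : PseudohermitianStructure n M) (e : OpenPartialHomeomorph M (CRModel n))
    (h : M → ℝ) : ℝ :=
  ∫ y in e.target, h (e.symm y) * P.density e y

/-- `Lu` is the sub-Laplacian `Δ_θ u` of the `C²` function `u`: `Lu` is continuous and
`∫ (Δ_θ u) φ dV_θ = - ∫ ⟨du, dφ⟩_θ dV_θ` for the smooth compactly supported functions `φ` on `M`.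
By linearity and partitions of unity it is enough to test with the `φ` that are supported in the
domain of one chart of the atlas, where the integrals are computed in coordinates. -/
def IsSubLaplacian (P : PseudohermitianStructure n M) (u Lu : M → ℝ) : Prop :=
  Continuous Lu ∧
    ∀ e ∈ atlas (CRModel n) M, ∀ φ : M → ℝ, ContMDiff 𝓘(ℝ, CRModel n) 𝓘(ℝ, ℝ) ∞ φ →
      HasCompactSupport φ → tsupport φ ⊆ e.source →
      P.chartIntegral e (fun x => Lu x * φ x) =
        -P.chartIntegral e (fun x => P.coInner x (differential n u x) (differential n φ x))

open Classical in
/-- The length of a tangent vector in the Levi metric, `∞` for vectors that are not in `G`. -/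
def horizontalNorm (P : PseudohermitianStructure n M) (x : M) (v : CRTangent n x) : ENNReal :=
  if h : v ∈ P.G x then ENNReal.ofReal √(P.levi x ⟨v, h⟩ ⟨v, h⟩) else ⊤

/-- The Carnot–Carathéodory distance `d_θ(x, y)`: the infimum of the lengths of the horizontal
`C¹` curves from `x` to `y` (`∞` if there is none). -/
def ccDist (P : PseudohermitianStructure n M) (x y : M) : ENNReal :=
  ⨅ (γ : ℝ → M) (_ : ContMDiffOn 𝓘(ℝ, ℝ) 𝓘(ℝ, CRModel n) 1 γ (Icc 0 1))
    (_ : γ 0 = x) (_ : γ 1 = y)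
    (_ : ∀ t ∈ Icc (0 : ℝ) 1,
      mfderivWithin 𝓘(ℝ, ℝ) 𝓘(ℝ, CRModel n) γ (Icc 0 1) t (1 : ℝ) ∈ P.G (γ t)),
    ∫⁻ t in Icc (0 : ℝ) 1, P.horizontalNorm (γ t)
      (mfderivWithin 𝓘(ℝ, ℝ) 𝓘(ℝ, CRModel n) γ (Icc 0 1) t (1 : ℝ))

/-- `(M, θ)` is complete: every Cauchy sequence of the Carnot–Carathéodory distance converges. -/
def IsComplete (P : PseudohermitianStructure n M) : Prop :=
  ∀ s : ℕ → M,
    (∀ ε : ENNReal, 0 < ε → ∃ N, ∀ k ≥ N, ∀ l ≥ N, P.ccDist (s k) (s l) < ε) →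
    ∃ x : M, Tendsto (fun k => P.ccDist (s k) x) atTop (𝓝 0)

/-- Condition A: there are a constant `A` and a smooth positive function `f` with `f → ∞` near
infinity, `|∇_θ f| ≤ A` and `Δ_θ f ≤ A` on `M`. -/
def ConditionA (P : PseudohermitianStructure n M) : Prop :=
  ∃ (A : ℝ) (f Lf : M → ℝ), ContMDiff 𝓘(ℝ, CRModel n) 𝓘(ℝ, ℝ) ∞ f ∧ (∀ x, 0 < f x) ∧
    Tendsto f (cocompact M) atTop ∧ P.IsSubLaplacian f Lf ∧
    (∀ x, P.gradNorm f x ≤ A) ∧ (∀ x, Lf x ≤ A)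

end PseudohermitianStructure

end

/-! Fix `ε > 0` and put `v = e^{-Ct} u - ε f - ε (A + 1) t`. As `u` is bounded and `f` is proper, `v
≤ 0` off a compact set, so a positive value of `v` forces a positive maximum at some `(x₀, t₀)`. The
initial condition gives `t₀ > 0`, and `u (x₀, t₀) > 0`. At this point `∂v/∂t ≥ 0`, while the
second-order condition in space gives `e^{-Ct} Δu ≤ ε Δf ≤ ε A`. The factor `e^{-Ct}` contributes
`-C u`, which absorbs `F ≤ C u`, so `∂v/∂t ≤ ε A - ε (A + 1) < 0`, a contradiction. Letting `ε → 0`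
gives `u ≤ 0`.

The main work is the second-order condition, because `Δ_θ` is only defined weakly. In a chart, `⟨α,
β⟩_θ` times the density `ρ` of `dV_θ` is `β (B α)` with `B` of class `C¹` and nonnegative
(`exists_chart_symbol`). Integration by parts and the fundamental lemma of the calculus of
variations turn the weak definition into `ρ Δ_θ w = div (B dw)` (`IsSubLaplacian.eqOn_divergence`).
At a local maximum `dw = 0`, so only the trace of `B` times the Hessian remains, and it is
nonpositive (`trace_symbol_hessian_nonpos`).

Dividing by `ρ` requires `ρ > 0`, that is, `θ ∧ (dθ)^n ≠ 0`. This is linear algebra: `dθ` is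
nondegenerate on `ker θ`, and the form is positive on a symplectic family completed by a vector with
`θ = 1`. -/

/-! ### Symplectic linear algebra -/

/-- A nondegenerate alternating form has symplectic families of every size that fits. -/
theorem exists_symplectic_family {V : Type*} [AddCommGroup V] [Module ℝ V] [FiniteDimensional ℝ V]
    (β : V →ₗ[ℝ] V →ₗ[ℝ] ℝ) (halt : ∀ v, β v v = 0) (hnd : ∀ v, v ≠ 0 → ∃ w, β v w ≠ 0)
    (k : ℕ) (hk : 2 * k ≤ Module.finrank ℝ V) :
    ∃ e f : ℕ → V, ∀ i < k, ∀ j < k, β (e i) (e j) = 0 ∧ β (f i) (f j) = 0 ∧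
      β (e i) (f j) = if i = j then 1 else 0 := by
  have hskew : ∀ v w, β v w = - β w v := by
    intro v w
    have h := halt (v + w)
    simp only [map_add, LinearMap.add_apply, halt] at h
    linarith
  induction k with
  | zero => exact ⟨0, 0, by simp⟩
  | succ k ih =>
    obtain ⟨e, f, hef⟩ := ih (by omega)
    -- The new vector `v` must be orthogonal to the `2 k` vectors already found; these are `2 k <
    -- dim V` linear equations, so a nonzero solution exists.
    let Φ : V →ₗ[ℝ] (Fin k → ℝ) × (Fin k → ℝ) :=
      LinearMap.prod (LinearMap.pi fun i => β (e i)) (LinearMap.pi fun i => β (f i))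
    have hker : Φ.ker ≠ ⊥ := by
      apply LinearMap.ker_ne_bot_of_finrank_lt
      simp
      omega
    obtain ⟨v, hv, hv0⟩ := Submodule.exists_mem_ne_zero_of_ne_bot hker
    have hΦ : Φ v = 0 := hv
    have hev : ∀ i < k, β (e i) v = 0 := fun i hi => congrFun (congrArg Prod.fst hΦ) ⟨i, hi⟩
    have hfv : ∀ i < k, β (f i) v = 0 := fun i hi => congrFun (congrArg Prod.snd hΦ) ⟨i, hi⟩
    have hve : ∀ i < k, β v (e i) = 0 := fun i hi => by rw [hskew, hev i hi, neg_zero]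
    have hvf : ∀ i < k, β v (f i) = 0 := fun i hi => by rw [hskew, hfv i hi, neg_zero]
    obtain ⟨g, hg⟩ := hnd v hv0
    let g' : V := (β v g)⁻¹ • g
    -- A symplectic Gram–Schmidt step: the sum cancels the pairings of `g'` with all `e i` and `f
    -- i`, and does not change `β v g' = 1` because `v` is orthogonal to them.
    let h : V := g' + ∑ i ∈ Finset.range k, (β (f i) g' • e i - β (e i) g' • f i)
    have hfe : ∀ i < k, ∀ j < k, β (f i) (e j) = if j = i then -1 else 0 := by
      intro i hi j hj
      rw [hskew, (hef j hj i hi).2.2]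
      split_ifs <;> simp
    have hvh : β v h = 1 := by
      have : ∑ i ∈ Finset.range k, β v (β (f i) g' • e i - β (e i) g' • f i) = 0 :=
        Finset.sum_eq_zero fun i hi => by
          have hi := Finset.mem_range.1 hi
          simp [hve i hi, hvf i hi]
      have hvg : β v h = β v g' := by simp only [h, map_add, map_sum, this, add_zero]
      rw [hvg, map_smul, smul_eq_mul, inv_mul_cancel₀ hg]
    have heh : ∀ i < k, β (e i) h = 0 := by
      intro i hi
      have : ∑ j ∈ Finset.range k, β (e i) (β (f j) g' • e j - β (e j) g' • f j) =
          ∑ j ∈ Finset.range k, if i = j then - β (e i) g' else 0 :=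
        Finset.sum_congr rfl fun j hj => by
          have hj := Finset.mem_range.1 hj
          simp only [map_sub, map_smul, hef i hi j hj, smul_eq_mul]
          split_ifs with hij
          · subst hij; ring
          · ring
      simp only [h, map_add, map_sum, this]
      simp [hi]
    have hfh : ∀ i < k, β (f i) h = 0 := by
      intro i hi
      have : ∑ j ∈ Finset.range k, β (f i) (β (f j) g' • e j - β (e j) g' • f j) =
          ∑ j ∈ Finset.range k, if i = j then - β (f i) g' else 0 :=
        Finset.sum_congr rfl fun j hj => by
          have hj := Finset.mem_range.1 hj
          simp only [map_sub, map_smul, hef i hi j hj, hfe i hi j hj, smul_eq_mul]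
          by_cases hij : i = j
          · subst hij; simp
          · simp [hij, Ne.symm hij]
      simp only [h, map_add, map_sum, this]
      simp [hi]
    refine ⟨fun i => if i = k then v else e i, fun i => if i = k then h else f i, ?_⟩
    intro i hi j hj
    by_cases hik : i = k <;> by_cases hjk : j = k
    · simp [hik, hjk, halt, hvh]
    · have hj' : j < k := by omega
      simp only [hik, hjk, if_true, if_false]
      rw [hskew h, hve j hj', hfh j hj', hvf j hj', if_neg (by omega)]
      simp
    · have hi' : i < k := by omega
      simp only [hik, hjk, if_true, if_false]
      rw [hev i hi', hfh i hi', heh i hi']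
      simp
    · simp only [hik, hjk, if_false]
      exact hef i (by omega) j (by omega)

/-! ### Nonvanishing of `θ ∧ β ^ n` -/

section WedgePower

variable {n : ℕ} {V : Type*} [AddCommGroup V] [Module ℝ V]

/-- The multilinear map `θ ⊗ β ⊗ ⋯ ⊗ β`. -/
def tensorPower (n : ℕ) (θ : V →ₗ[ℝ] ℝ) (β : V →ₗ[ℝ] V →ₗ[ℝ] ℝ) :
    MultilinearMap ℝ (fun _ : Option (Fin n × Bool) => V) ℝ :=
  MultilinearMap.mk' (fun v => θ (v none) * ∏ k : Fin n, β (v (some (k, false))) (v (some (k, true))))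
    (by
      rintro v (_ | ⟨k, b⟩) x y
      · simp [add_mul]
      · rw [← Finset.prod_erase_mul _ _ (Finset.mem_univ k),
          ← Finset.prod_erase_mul _ _ (Finset.mem_univ k),
          ← Finset.prod_erase_mul _ _ (Finset.mem_univ k)]
        have : ∀ z, ∏ j ∈ Finset.univ.erase k, β (Function.update v (some (k, b)) z (some (j, false)))
            (Function.update v (some (k, b)) z (some (j, true))) =
            ∏ j ∈ Finset.univ.erase k, β (v (some (j, false))) (v (some (j, true))) := fun z =>
          Finset.prod_congr rfl fun j hj => by
            have hj := Finset.ne_of_mem_erase hj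
            simp [hj]
        rw [this, this, this]
        cases b <;> simp <;> ring)
    (by
      rintro v (_ | ⟨k, b⟩) c x
      · simp [mul_assoc]
      · rw [← Finset.prod_erase_mul _ _ (Finset.mem_univ k),
          ← Finset.prod_erase_mul _ _ (Finset.mem_univ k)]
        have : ∀ z, ∏ j ∈ Finset.univ.erase k, β (Function.update v (some (k, b)) z (some (j, false)))
            (Function.update v (some (k, b)) z (some (j, true))) =
            ∏ j ∈ Finset.univ.erase k, β (v (some (j, false))) (v (some (j, true))) := fun z =>
          Finset.prod_congr rfl fun j hj => by
            have hj := Finset.ne_of_mem_erase hj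
            simp [hj]
        rw [this, this]
        cases b <;> simp <;> ring)

lemma tensorPower_apply (θ : V →ₗ[ℝ] ℝ) (β : V →ₗ[ℝ] V →ₗ[ℝ] ℝ) (v : Option (Fin n × Bool) → V) :
    tensorPower n θ β v = θ (v none) * ∏ k : Fin n, β (v (some (k, false))) (v (some (k, true))) :=
  rfl

/-- Up to a constant, the alternating form `θ ∧ β ^ n`. -/
def wedgePower (n : ℕ) (θ : V →ₗ[ℝ] ℝ) (β : V →ₗ[ℝ] V →ₗ[ℝ] ℝ) :
    V [⋀^Option (Fin n × Bool)]→ₗ[ℝ] ℝ :=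
  MultilinearMap.alternatization (tensorPower n θ β)

lemma wedgePower_apply (θ : V →ₗ[ℝ] ℝ) (β : V →ₗ[ℝ] V →ₗ[ℝ] ℝ) (v : Option (Fin n × Bool) → V) :
    wedgePower n θ β v = ∑ σ : Equiv.Perm (Option (Fin n × Bool)),
      ((Equiv.Perm.sign σ : ℤ) : ℝ) * (θ (v (σ none)) *
        ∏ k : Fin n, β (v (σ (some (k, false)))) (v (σ (some (k, true))))) := by
  simp only [wedgePower, MultilinearMap.alternatization_apply]
  refine Finset.sum_congr rfl fun σ _ => ?_
  simp [Units.smul_def, tensorPower_apply]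

/-- The right-hand side has the shape of the table of values of `β` on a symplectic pair, so that
each factor `β` of a surviving term can be recognised as a sign. -/
lemma sign_perm_bool (s : Equiv.Perm Bool) :
    ((Equiv.Perm.sign s : ℤ) : ℝ) =
      if s false = false ∧ s true = true then 1 else if s false = true ∧ s true = false then -1
        else 0 := by
  have : ∀ s : Equiv.Perm Bool, (Equiv.Perm.sign s : ℤ) =
      if s false = false ∧ s true = true then 1 else if s false = true ∧ s true = false then -1
        else 0 := by decide
  rw [this]
  push_cast
  rfl

/-- The terms of `θ ∧ β ^ n` on a symplectic family are nonnegative. -/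
lemma wedge_term_nonneg (θ : V →ₗ[ℝ] ℝ) (β : V →ₗ[ℝ] V →ₗ[ℝ] ℝ)
    (v : Option (Fin n × Bool) → V) (h0 : θ (v none) = 1) (hs : ∀ p, θ (v (some p)) = 0)
    (hβ : ∀ i j b c, β (v (some (i, b))) (v (some (j, c))) =
      if i = j then (if b = false ∧ c = true then 1 else if b = true ∧ c = false then -1 else 0)
        else 0)
    (σ : Equiv.Perm (Option (Fin n × Bool))) :
    0 ≤ ((Equiv.Perm.sign σ : ℤ) : ℝ) * (θ (v (σ none)) *
        ∏ k : Fin n, β (v (σ (some (k, false)))) (v (σ (some (k, true))))) := by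
  -- A permutation contributes only if it fixes the slot of `θ`, since `θ` kills the other vectors,
  -- and if it maps pairs to pairs, since distinct pairs are `β`-orthogonal.
  by_cases hnone : σ none = none
  swap
  · obtain ⟨p, hp⟩ := Option.ne_none_iff_exists'.1 hnone
    rw [hp, hs]; simp
  have hopt := Equiv.optionCongr_sign (Equiv.removeNone σ)
  have hσ : Equiv.optionCongr (Equiv.removeNone σ) = σ := by
    ext1 x
    cases x with
    | none => simp [hnone]
    | some p => 
      rw [Equiv.optionCongr_apply, Option.map_some]
      refine Equiv.removeNone_some σ (Option.ne_none_iff_exists'.1 fun h => ?_)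
      exact Option.some_ne_none p (σ.injective (h.trans hnone.symm))
  set τ := Equiv.removeNone σ with hτ
  have hστ : ∀ p, σ (some p) = some (τ p) := fun p => by
    conv_lhs => rw [← hσ]
    simp
  rw [hσ] at hopt
  by_cases hpair : ∀ k, (τ (k, false)).1 = (τ (k, true)).1
  swap
  · push Not at hpair
    obtain ⟨k, hk⟩ := hpair
    have : ∏ k : Fin n, β (v (σ (some (k, false)))) (v (σ (some (k, true)))) = 0 := by
      apply Finset.prod_eq_zero (Finset.mem_univ k)
      rw [hστ, hστ, ← Prod.mk.eta (p := τ (k, false)), ← Prod.mk.eta (p := τ (k, true)), hβ,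
        if_neg hk]
    rw [this]; simp
  let π₀ : Fin n → Fin n := fun k => (τ (k, false)).1
  have hπ₀ : ∀ k b, (τ (k, b)).1 = π₀ k := by
    intro k b; cases b
    · rfl
    · exact (hpair k).symm
  have hπsurj : Function.Surjective π₀ := by
    intro j
    obtain ⟨⟨k, b⟩, hkb⟩ := τ.surjective (j, false)
    exact ⟨k, by rw [← hπ₀ k b, hkb]⟩
  let π : Equiv.Perm (Fin n) :=
    Equiv.ofBijective π₀ ⟨Finite.injective_iff_surjective.2 hπsurj, hπsurj⟩
  have hsinj : ∀ k, Function.Injective fun b => (τ (k, b)).2 := by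
    intro k b c hbc
    have : τ (k, b) = τ (k, c) := Prod.ext ((hπ₀ k b).trans (hπ₀ k c).symm) hbc
    simpa using τ.injective this
  let s : Fin n → Equiv.Perm Bool := fun k =>
    Equiv.ofBijective _ ⟨hsinj k, Finite.injective_iff_surjective.1 (hsinj k)⟩
  have hs_apply : ∀ k b, s k b = (τ (k, b)).2 := fun k b => rfl
  -- Such a permutation swaps or keeps the members of each pair (`s k`) and then permutes the pairs
  -- (`π`). In the sign, `π` occurs once for each element of `Bool`, hence squared, and only the
  -- signs of the `s k` remain; their product is also the product of the factors `β`, so the term is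
  -- a square.
  have hτeq : τ = (Equiv.prodCongrLeft fun _ : Bool => π) * Equiv.prodCongrRight s := by
    ext1 ⟨k, b⟩
    exact Prod.ext (hπ₀ k b) rfl
  have hsign : ((Equiv.Perm.sign σ : ℤ) : ℝ) = ∏ k, ((Equiv.Perm.sign (s k) : ℤ) : ℝ) := by
    rw [hopt, hτeq, Equiv.Perm.sign_mul, Equiv.Perm.sign_prodCongrLeft,
      Equiv.Perm.sign_prodCongrRight]
    simp
  have hprod : ∏ k : Fin n, β (v (σ (some (k, false)))) (v (σ (some (k, true)))) =
      ∏ k, ((Equiv.Perm.sign (s k) : ℤ) : ℝ) := by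
    refine Finset.prod_congr rfl fun k _ => ?_
    rw [hστ, hστ, ← Prod.mk.eta (p := τ (k, false)), ← Prod.mk.eta (p := τ (k, true)), hβ,
      if_pos (hpair k), sign_perm_bool]
    rfl
  rw [hnone, h0, hprod, hsign, one_mul]
  exact mul_self_nonneg _

/-- `θ ∧ β ^ n` is positive on a symplectic family. -/
lemma wedgePower_pos (θ : V →ₗ[ℝ] ℝ) (β : V →ₗ[ℝ] V →ₗ[ℝ] ℝ)
    (v : Option (Fin n × Bool) → V) (h0 : θ (v none) = 1) (hs : ∀ p, θ (v (some p)) = 0)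
    (hβ : ∀ i j b c, β (v (some (i, b))) (v (some (j, c))) =
      if i = j then (if b = false ∧ c = true then 1 else if b = true ∧ c = false then -1 else 0)
        else 0) :
    0 < wedgePower n θ β v := by
  rw [wedgePower_apply]
  refine Finset.sum_pos' (fun σ _ => wedge_term_nonneg θ β v h0 hs hβ σ) ⟨1, Finset.mem_univ _, ?_⟩
  simp [h0, hβ]

/-- `θ ∧ β ^ n` does not vanish if `β` is nondegenerate on a `2n`-dimensional kernel of `θ`. -/
theorem wedgePower_basis_ne_zero [FiniteDimensional ℝ V] (θ : V →ₗ[ℝ] ℝ) (β : V →ₗ[ℝ] V →ₗ[ℝ] ℝ)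
    (halt : ∀ v, β v v = 0) (hdim : 2 * n ≤ Module.finrank ℝ θ.ker) (hθ : θ ≠ 0)
    (hnd : ∀ v ∈ θ.ker, v ≠ 0 → ∃ w ∈ θ.ker, β v w ≠ 0)
    (b : Module.Basis (Option (Fin n × Bool)) ℝ V) : wedgePower n θ β b ≠ 0 := by
  -- A form of top degree that is nonzero on some family is nonzero on every basis, so a symplectic
  -- family may replace `b`.
  rw [AlternatingMap.map_basis_ne_zero_iff]
  obtain ⟨t, ht⟩ : ∃ t, θ t ≠ 0 := by
    by_contra! h
    exact hθ (LinearMap.ext h)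
  have hskew : ∀ v w, β v w = - β w v := by
    intro v w
    have h := halt (v + w)
    simp only [map_add, LinearMap.add_apply, halt] at h
    linarith
  obtain ⟨e, f, hef⟩ := exists_symplectic_family (V := θ.ker)
    ((β.domRestrict θ.ker).compl₂ θ.ker.subtype) (fun v => halt v)
    (fun v hv => by
      obtain ⟨w, hw, hvw⟩ := hnd v v.2 (by simpa using hv)
      exact ⟨⟨w, hw⟩, hvw⟩) n hdim
  simp only [LinearMap.compl₂_apply, LinearMap.domRestrict_apply, Submodule.subtype_apply] at hef
  let v : Option (Fin n × Bool) → V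
    | none => (θ t)⁻¹ • t
    | some (k, false) => e k
    | some (k, true) => f k
  have hpos : 0 < wedgePower n θ β v := by
    apply wedgePower_pos
    · simp [v, ht]
    · rintro ⟨k, _ | _⟩
      · exact (e k).2
      · exact (f k).2
    · rintro i j (_ | _) (_ | _)
      · simp [v, (hef i i.2 j j.2).1]
      · simp [v, (hef i i.2 j j.2).2.2, Fin.ext_iff]
      · have := (hef j j.2 i i.2).2.2
        simp only [v, hskew (f i), this]
        by_cases hij : i = j
        · simp [hij]
        · simp [hij, Fin.val_ne_of_ne (Ne.symm hij)]
      · simp [v, (hef i i.2 j j.2).2.1]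
  intro h
  rw [h] at hpos
  simp at hpos

end WedgePower

/-! ### One-forms and vector fields in charts -/

/-- The exterior derivative commutes with pull-back by a `C²` map. -/
theorem extDeriv_comp_fderiv {E : Type*} [NormedAddCommGroup E] [NormedSpace ℝ E]
    {α : E → E →L[ℝ] ℝ} {φ : E → E} {y : E} (hα : DifferentiableAt ℝ α (φ y))
    (hφ : ContDiffAt ℝ 2 φ y) (v w : E) :
    fderiv ℝ (fun z => (α (φ z)).comp (fderiv ℝ φ z)) y v w -
      fderiv ℝ (fun z => (α (φ z)).comp (fderiv ℝ φ z)) y w v =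
    fderiv ℝ α (φ y) (fderiv ℝ φ y v) (fderiv ℝ φ y w) -
      fderiv ℝ α (φ y) (fderiv ℝ φ y w) (fderiv ℝ φ y v) := by
  have hφ1 : DifferentiableAt ℝ φ y := hφ.differentiableAt (by norm_num)
  have hφ2 : DifferentiableAt ℝ (fderiv ℝ φ) y :=
    (hφ.fderiv_right (m := 1) (by norm_num)).differentiableAt (by norm_num)
  have hαφ : DifferentiableAt ℝ (fun z => α (φ z)) y := hα.comp y hφ1
  have hsymm : IsSymmSndFDerivAt ℝ φ y := hφ.isSymmSndFDerivAt (by simp)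
  have hfd : fderiv ℝ (fun z => α (φ z)) y = (fderiv ℝ α (φ y)).comp (fderiv ℝ φ y) :=
    fderiv_comp y hα hφ1
  -- The product rule produces one term with the second derivative of `φ`; it is symmetric in `v`
  -- and `w` and cancels in the difference.
  rw [fderiv_clm_comp hαφ hφ2, hfd]
  simp [hsymm.eq v w]

/-- The exterior derivative of a 1-form in the coordinates of a chart. -/
noncomputable def chartExtDeriv {n : ℕ} {M : Type*} [TopologicalSpace M] [ChartedSpace (CRModel n) M]
    (θ : ∀ x : M, CRTangent n x →L[ℝ] ℝ) (e : OpenPartialHomeomorph M (CRModel n))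
    (y : CRModel n) : CRModel n →ₗ[ℝ] CRModel n →ₗ[ℝ] ℝ :=
  LinearMap.mk₂ ℝ (fun v w => fderiv ℝ (chartForm θ e) y v w - fderiv ℝ (chartForm θ e) y w v)
    (by intros; simp; ring) (by intros; simp; ring) (by intros; simp; ring) (by intros; simp; ring)

section Chart

variable {n : ℕ} {M : Type*} [TopologicalSpace M] [ChartedSpace (CRModel n) M]
  {e e' : OpenPartialHomeomorph M (CRModel n)}

lemma chartExtDeriv_apply (θ : ∀ x : M, CRTangent n x →L[ℝ] ℝ)
    (e : OpenPartialHomeomorph M (CRModel n)) (y v w : CRModel n) :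
    chartExtDeriv θ e y v w =
      fderiv ℝ (chartForm θ e) y v w - fderiv ℝ (chartForm θ e) y w v := rfl

lemma contDiffOn_chartExtDeriv {θ : ∀ x : M, CRTangent n x →L[ℝ] ℝ} (hθ : IsSmoothOneForm θ)
    (he : e ∈ atlas (CRModel n) M) {s : Set (CRModel n)} (hs : s ⊆ e.target) (hso : IsOpen s)
    {v w : CRModel n → CRModel n}
    (hv : ContDiffOn ℝ 1 v s) (hw : ContDiffOn ℝ 1 w s) :
    ContDiffOn ℝ 1 (fun y => chartExtDeriv θ e y (v y) (w y)) s := by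
  have h : ContDiffOn ℝ 1 (fderiv ℝ (chartForm θ e)) s :=
    ((hθ e he).mono hs).fderiv_of_isOpen hso (by norm_cast)
  simp only [chartExtDeriv_apply]
  exact ((h.clm_apply hv).clm_apply hw).sub ((h.clm_apply hw).clm_apply hv)

variable [IsManifold 𝓘(ℝ, CRModel n) ∞ M]

lemma atlas_mdifferentiable (he : e ∈ atlas (CRModel n) M) :
    e.MDifferentiable 𝓘(ℝ, CRModel n) 𝓘(ℝ, CRModel n) :=
  haveI : IsManifold 𝓘(ℝ, CRModel n) 1 M := IsManifold.of_le (n := ∞) (by norm_num)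
  mdifferentiable_of_mem_atlas he

lemma mfderiv_symm_mfderiv (he : e ∈ atlas (CRModel n) M) {y : CRModel n} (hy : y ∈ e.target)
    (v : CRTangent n (e.symm y)) :
    mfderiv 𝓘(ℝ, CRModel n) 𝓘(ℝ, CRModel n) e.symm y
      (mfderiv 𝓘(ℝ, CRModel n) 𝓘(ℝ, CRModel n) e (e.symm y) v) = v := by
  have h := (atlas_mdifferentiable he).symm_comp_deriv (e.map_target hy)
  rw [e.right_inv hy] at h
  exact congrArg (fun L => L v) h

lemma mfderiv_mfderiv_symm (he : e ∈ atlas (CRModel n) M) {y : CRModel n} (hy : y ∈ e.target)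
    (v : CRModel n) :
    mfderiv 𝓘(ℝ, CRModel n) 𝓘(ℝ, CRModel n) e (e.symm y)
      (mfderiv 𝓘(ℝ, CRModel n) 𝓘(ℝ, CRModel n) e.symm y v) = v :=
  congrArg (fun L => L v) ((atlas_mdifferentiable he).comp_symm_deriv hy)

lemma contMDiffOn_atlas (he : e ∈ atlas (CRModel n) M) :
    ContMDiffOn 𝓘(ℝ, CRModel n) 𝓘(ℝ, CRModel n) ∞ e e.source :=
  contMDiffOn_of_mem_maximalAtlas (IsManifold.subset_maximalAtlas he)

lemma contMDiffOn_atlas_symm (he : e ∈ atlas (CRModel n) M) :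
    ContMDiffOn 𝓘(ℝ, CRModel n) 𝓘(ℝ, CRModel n) ∞ e.symm e.target :=
  contMDiffOn_symm_of_mem_maximalAtlas (IsManifold.subset_maximalAtlas he)

lemma contDiffAt_transition (he : e ∈ atlas (CRModel n) M) (he' : e' ∈ atlas (CRModel n) M)
    {y : CRModel n} (hy : y ∈ e.target) (hy' : e.symm y ∈ e'.source) :
    ContDiffAt ℝ ∞ (e' ∘ e.symm) y := by
  rw [← contMDiffAt_iff_contDiffAt]
  exact ((contMDiffOn_atlas he').contMDiffAt (e'.open_source.mem_nhds hy')).comp y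
    ((contMDiffOn_atlas_symm he).contMDiffAt (e.open_target.mem_nhds hy))

lemma fderiv_transition (he : e ∈ atlas (CRModel n) M) (he' : e' ∈ atlas (CRModel n) M)
    {y : CRModel n} (hy : y ∈ e.target) (hy' : e.symm y ∈ e'.source) (v : CRModel n) :
    fderiv ℝ (e' ∘ e.symm) y v = mfderiv 𝓘(ℝ, CRModel n) 𝓘(ℝ, CRModel n) e' (e.symm y)
      (mfderiv 𝓘(ℝ, CRModel n) 𝓘(ℝ, CRModel n) e.symm y v) := by
  rw [← mfderiv_eq_fderiv, mfderiv_comp y ((atlas_mdifferentiable he').mdifferentiableAt hy')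
    ((atlas_mdifferentiable he).mdifferentiableAt_symm hy)]
  rfl

lemma chartForm_transition (θ : ∀ x : M, CRTangent n x →L[ℝ] ℝ)
    (he : e ∈ atlas (CRModel n) M) (he' : e' ∈ atlas (CRModel n) M)
    {y : CRModel n} (hy : y ∈ e.target) (hy' : e.symm y ∈ e'.source) :
    chartForm θ e y =
      (chartForm θ e' ((e' ∘ e.symm) y)).comp (fderiv ℝ (e' ∘ e.symm) y) := by
  ext v
  rw [ContinuousLinearMap.comp_apply, fderiv_transition he he' hy hy']
  have key : ∀ x : M, x ∈ e'.source → ∀ u : CRTangent n x,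
      chartForm θ e' (e' x) (mfderiv 𝓘(ℝ, CRModel n) 𝓘(ℝ, CRModel n) e' x u) = θ x u := by
    intro x hx u
    have h := congrArg (fun L => L u) ((atlas_mdifferentiable he').symm_comp_deriv hx)
    have h' : mfderiv 𝓘(ℝ, CRModel n) 𝓘(ℝ, CRModel n) e'.symm (e' x)
      (mfderiv 𝓘(ℝ, CRModel n) 𝓘(ℝ, CRModel n) e' x u) = u := h
    change θ (e'.symm (e' x)) (mfderiv 𝓘(ℝ, CRModel n) 𝓘(ℝ, CRModel n) e'.symm (e' x)
      (mfderiv 𝓘(ℝ, CRModel n) 𝓘(ℝ, CRModel n) e' x u)) = θ x u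
    rw [h']
    -- The covectors at `e'.symm (e' x)` and at `x` have different types; generalising the base
    -- point allows the equality of points to be substituted.
    have : ∀ x' (_ : x' = x), (θ x' : CRModel n →L[ℝ] ℝ) u = (θ x : CRModel n →L[ℝ] ℝ) u := by
      rintro _ rfl; rfl
    exact this _ (e'.left_inv hx)
  exact (key _ hy' _).symm

/-- `dθ` may be computed in any chart. -/
theorem oneFormExtDeriv_chart {θ : ∀ x : M, CRTangent n x →L[ℝ] ℝ} (hθ : IsSmoothOneForm θ)
    (he : e ∈ atlas (CRModel n) M) {y : CRModel n} (hy : y ∈ e.target) (v w : CRModel n) :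
    oneFormExtDeriv θ (e.symm y) (mfderiv 𝓘(ℝ, CRModel n) 𝓘(ℝ, CRModel n) e.symm y v)
      (mfderiv 𝓘(ℝ, CRModel n) 𝓘(ℝ, CRModel n) e.symm y w) = chartExtDeriv θ e y v w := by
  set e' := chartAt (CRModel n) (e.symm y) with he'def
  have he' : e' ∈ atlas (CRModel n) M := chart_mem_atlas _ _
  have hy' : e.symm y ∈ e'.source := mem_chart_source _ _
  -- The transition formula is needed on a whole neighbourhood, with the chart `e'` at `e.symm y`
  -- held fixed, because it is going to be differentiated.
  have hev : chartForm θ e =ᶠ[𝓝 y] fun z =>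
      (chartForm θ e' ((e' ∘ e.symm) z)).comp (fderiv ℝ (e' ∘ e.symm) z) := by
    have h1 : ∀ᶠ z in 𝓝 y, z ∈ e.target := e.open_target.mem_nhds hy
    have h2 : ∀ᶠ z in 𝓝 y, e.symm z ∈ e'.source :=
      (e.continuousAt_symm hy).eventually (e'.open_source.mem_nhds hy')
    filter_upwards [h1, h2] with z hz hz'
    exact chartForm_transition θ he he' hz hz'
  have hα : DifferentiableAt ℝ (chartForm θ e') ((e' ∘ e.symm) y) :=
    ((hθ e' he').contDiffAt (e'.open_target.mem_nhds (e'.map_source hy'))).differentiableAt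
      (by simp)
  rw [chartExtDeriv_apply, hev.fderiv_eq, extDeriv_comp_fderiv hα
    ((contDiffAt_transition he he' hy hy').of_le (by norm_cast)), fderiv_transition he he' hy hy',
    fderiv_transition he he' hy hy']
  rfl

/-- The coordinate expression of a smooth vector field is smooth. -/
lemma contDiffOn_chart_vectorField (he : e ∈ atlas (CRModel n) M)
    {V : ∀ x : M, CRTangent n x} {U : Set M} (hV : IsSmoothVectorFieldOn n V U) :
    ContDiffOn ℝ 1 (fun y => (mfderiv 𝓘(ℝ, CRModel n) 𝓘(ℝ, CRModel n) e (e.symm y)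
      (V (e.symm y)) : CRModel n)) (e.target ∩ e.symm ⁻¹' U) := by
  -- The coordinate expression is the fibre component of the tangent map of `e` composed with the
  -- section `V`.
  have h1 := (contMDiffOn_atlas he).contMDiffOn_tangentMapWithin (m := 1) (by norm_cast)
    e.open_source.uniqueMDiffOn
  have h2 : ContMDiffOn 𝓘(ℝ, CRModel n) 𝓘(ℝ, CRModel n).tangent 1
      (fun y => (⟨e.symm y, V (e.symm y)⟩ : TangentBundle 𝓘(ℝ, CRModel n) M))
      (e.target ∩ e.symm ⁻¹' U) :=
    (hV.of_le (by norm_cast)).comp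
      (((contMDiffOn_atlas_symm he).of_le (by norm_cast)).mono inter_subset_left)
      (fun y hy => hy.2)
  have h3 := h1.comp h2 (fun y hy => e.map_target hy.1)
  have h4 := (contMDiff_snd_tangentBundle_modelSpace (n := 1) (CRModel n) 𝓘(ℝ, CRModel n)).comp_contMDiffOn h3
  rw [contMDiffOn_iff_contDiffOn] at h4
  refine h4.congr fun y hy => ?_
  change _ = mfderivWithin 𝓘(ℝ, CRModel n) 𝓘(ℝ, CRModel n) e e.source (e.symm y) (V (e.symm y))
  rw [mfderivWithin_of_isOpen e.open_source (e.map_target hy.1)]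

end Chart

/-! ### Smooth dependence of matrices -/

lemma contDiffOn_det {E ι : Type*} [NormedAddCommGroup E] [NormedSpace ℝ E] [Fintype ι]
    [DecidableEq ι] {k : WithTop ℕ∞} {A : E → Matrix ι ι ℝ} {s : Set E}
    (hA : ∀ i j, ContDiffOn ℝ k (fun y => A y i j) s) : ContDiffOn ℝ k (fun y => (A y).det) s := by
  simp only [Matrix.det_apply']
  exact ContDiffOn.sum fun σ _ => contDiffOn_const.mul (contDiffOn_prod fun i _ => hA _ _)

/-- Cramer's rule: each entry is a polynomial in the entries of `A` divided by `det A`. -/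
lemma contDiffOn_matrix_inv {E ι : Type*} [NormedAddCommGroup E] [NormedSpace ℝ E] [Fintype ι]
    [DecidableEq ι] {k : WithTop ℕ∞} {A : E → Matrix ι ι ℝ} {s : Set E}
    (hA : ∀ i j, ContDiffOn ℝ k (fun y => A y i j) s) (h0 : ∀ y ∈ s, (A y).det ≠ 0) (i j : ι) :
    ContDiffOn ℝ k (fun y => (A y)⁻¹ i j) s := by
  simp only [Matrix.inv_def, Matrix.smul_apply, Ring.inverse_eq_inv', Matrix.adjugate_apply,
    smul_eq_mul]
  refine ((contDiffOn_det hA).inv h0).mul (contDiffOn_det fun a b => ?_)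
  by_cases h : a = j
  · subst h; simp only [Matrix.updateRow_self]; exact contDiffOn_const
  · simp only [Matrix.updateRow_ne h]; exact hA a b

/-- The shape in which the symbol of the sub-Laplacian is assembled: `ρ` is the volume density, `c`
the inverse Gram matrix and `X` a frame of `G`. -/
lemma contDiffOn_sum_smulRight {E ι : Type*} [NormedAddCommGroup E] [NormedSpace ℝ E] [Fintype ι]
    {k : WithTop ℕ∞} {ρ : E → ℝ} {c : E → Matrix ι ι ℝ} {X : ι → E → E} {s : Set E}
    (hρ : ContDiffOn ℝ k ρ s) (hc : ∀ i j, ContDiffOn ℝ k (fun y => c y i j) s)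
    (hX : ∀ i, ContDiffOn ℝ k (X i) s) :
    ContDiffOn ℝ k (fun y => ∑ b, ∑ a,
      (ContinuousLinearMap.apply ℝ ℝ (X a y)).smulRight ((ρ y * c y b a) • X b y)) s := by
  refine ContDiffOn.sum fun b _ => ContDiffOn.sum fun a _ => ?_
  have h1 : ContDiff ℝ k fun v : E => ContinuousLinearMap.apply ℝ ℝ v :=
    ContinuousLinearMap.contDiff (F := (E →L[ℝ] ℝ) →L[ℝ] ℝ) _
  exact (h1.comp_contDiffOn (hX a)).smulRight ((hρ.mul (hc b a)).smul (hX b))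

/-- The enumeration `0, (1, 2), (3, 4), …` of the slots of `θ ∧ (dθ) ^ n`. -/
noncomputable def slotEquiv (n : ℕ) : Option (Fin n × Bool) ≃ Fin (2 * n + 1) :=
  Equiv.ofBijective
    (fun p => match p with
      | none => ⟨0, by omega⟩
      | some (k, false) => ⟨2 * k.1 + 1, by omega⟩
      | some (k, true) => ⟨2 * k.1 + 2, by omega⟩)
    (by
      rw [Fintype.bijective_iff_injective_and_card]
      refine ⟨?_, by simp; ring⟩
      rintro (_ | ⟨k, _ | _⟩) (_ | ⟨l, _ | _⟩) h <;> simp [Fin.ext_iff] at h ⊢ <;> omega)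

/-! ### The Levi metric, the volume density and the symbol in a chart -/

namespace PseudohermitianStructure

variable {n : ℕ} {M : Type*} [TopologicalSpace M] [ChartedSpace (CRModel n) M]
  [IsManifold 𝓘(ℝ, CRModel n) ∞ M] {e : OpenPartialHomeomorph M (CRModel n)}

lemma levi_self_pos (P : PseudohermitianStructure n M) (x : M) {v : P.G x} (hv : v ≠ 0) :
    0 < P.levi x v v := P.levi_pos x v hv

lemma coInner_self_nonneg (P : PseudohermitianStructure n M) (x : M) (α : CRTangent n x →L[ℝ] ℝ) :
    0 ≤ P.coInner x α α := by
  by_cases h : P.sharp x α = 0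
  · simp [coInner, h]
  · exact (P.levi_self_pos x h).le

/-- A null vector `c` of the Gram matrix gives `v = ∑ c a • E a` that pairs to zero with every `E
b`, so `L_θ(v, v) = 0` and `v = 0` by positivity. Symmetry of the Levi form plays no role. -/
lemma gram_det_ne_zero (P : PseudohermitianStructure n M) (x : M) {ι : Type*} [Fintype ι]
    [DecidableEq ι] {E : ι → P.G x} (hE : LinearIndependent ℝ E) :
    (Matrix.of fun a b => P.levi x (E a) (E b)).det ≠ 0 := by
  intro hdet
  obtain ⟨c, hc0, hc⟩ := Matrix.exists_vecMul_eq_zero_iff.2 hdet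
  have h : ∀ b, P.levi x (∑ a, c a • E a) (E b) = 0 := fun b => by
    have := congrFun hc b
    simpa [Matrix.vecMul, dotProduct] using this
  have h0 : ∑ a, c a • E a = 0 := by
    by_contra hne
    have hpos := P.levi_self_pos x hne
    rw [map_sum] at hpos
    simp only [map_smul, h, smul_zero, Finset.sum_const_zero, lt_irrefl] at hpos
  exact hc0 (funext (Fintype.linearIndependent_iff.1 hE c h0))

/-- The inner product of covectors in terms of a basis of `G`. -/
lemma coInner_eq_sum (P : PseudohermitianStructure n M) (x : M) {ι : Type*} [Fintype ι]
    [DecidableEq ι] {E : ι → P.G x} (hE : LinearIndependent ℝ E)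
    (hspan : Submodule.span ℝ (range E) = ⊤) (α β : CRTangent n x →L[ℝ] ℝ) :
    P.coInner x α β = ∑ b, ∑ a, (Matrix.of fun a b => P.levi x (E a) (E b))⁻¹ b a *
      α (E a) * β (E b) := by
  set g := Matrix.of fun a b => P.levi x (E a) (E b) with hg
  have hdet : IsUnit g.det := (P.gram_det_ne_zero x hE).isUnit
  set c := Matrix.vecMul (fun b => β (E b)) g⁻¹ with hc
  have hcg : Matrix.vecMul c g = fun b => β (E b) := by
    rw [hc, Matrix.vecMul_vecMul, Matrix.nonsing_inv_mul _ hdet, Matrix.vecMul_one]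
  have hsharp : P.sharp x β = ∑ a, c a • E a := by
    apply P.levi_injective x
    refine LinearMap.ext_on_range hspan fun b => ?_
    rw [P.levi_sharp, ← congrFun hcg b]
    simp [Matrix.vecMul, dotProduct, hg]
  -- Since `L_θ(α^♯, ·) = α` on `G`, the inner product is `α (β^♯)`, and only `β^♯` has to be
  -- expanded in the basis.
  rw [coInner, P.levi_sharp, hsharp]
  simp only [Submodule.coe_sum, Submodule.coe_smul, map_sum, map_smul, smul_eq_mul]
  rw [Finset.sum_comm]
  refine Finset.sum_congr rfl fun a _ => ?_
  simp only [hc, Matrix.vecMul, dotProduct, Finset.sum_mul]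
  exact Finset.sum_congr rfl fun b _ => by ring

/-- If `θ` vanished at a point, `G` would be the whole tangent space, of dimension `2 n + 1`,
although it is spanned by the `2 n` vectors of a frame. -/
lemma chartForm_ne_zero (P : PseudohermitianStructure n M) (he : e ∈ atlas (CRModel n) M)
    {y : CRModel n} (hy : y ∈ e.target) : chartForm P.θ e y ≠ 0 := by
  intro h
  obtain ⟨U, X, Y, -, hxU, -, -, hfr⟩ := P.frame (e.symm y)
  obtain ⟨-, -, hspan⟩ := hfr _ hxU
  have htop : P.G (e.symm y) = ⊤ := by
    refine Submodule.eq_top_iff'.2 fun v => (P.mem_G_iff _ v).2 ?_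
    rw [← mfderiv_symm_mfderiv he hy v]
    exact congrArg (fun L => L (mfderiv 𝓘(ℝ, CRModel n) 𝓘(ℝ, CRModel n) e (e.symm y) v)) h
  have h1 := finrank_range_le_card (R := ℝ)
    (Sum.elim (fun a => X a (e.symm y)) (fun a => Y a (e.symm y)))
  rw [Set.finrank, hspan, htop, finrank_top] at h1
  have h2 : Module.finrank ℝ (CRTangent n (e.symm y)) = 2 * n + 1 :=
    finrank_euclideanSpace_fin (𝕜 := ℝ) (n := 2 * n + 1)
  simp only [Fintype.card_sum, Fintype.card_fin] at h1
  omega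

/-- The left side computes `dθ` in a chart that changes with the point; the right side uses one
fixed chart, which makes the dependence on `y` visibly smooth. -/
lemma volumeForm_chart (P : PseudohermitianStructure n M) (he : e ∈ atlas (CRModel n) M)
    {y : CRModel n} (hy : y ∈ e.target) :
    P.volumeForm (e.symm y) (fun i => mfderiv 𝓘(ℝ, CRModel n) 𝓘(ℝ, CRModel n) e.symm y
      (EuclideanSpace.single i (1 : ℝ) : CRModel n)) =
    (1 / 2 ^ n : ℝ) * ∑ σ : Equiv.Perm (Fin (2 * n + 1)), ((Equiv.Perm.sign σ : ℤ) : ℝ) *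
      chartForm P.θ e y (EuclideanSpace.single (σ ⟨0, by omega⟩) (1 : ℝ)) *
      ∏ k : Fin n, chartExtDeriv P.θ e y
        (EuclideanSpace.single (σ ⟨2 * k.1 + 1, by omega⟩) (1 : ℝ))
        (EuclideanSpace.single (σ ⟨2 * k.1 + 2, by omega⟩) (1 : ℝ)) := by
  simp only [volumeForm, oneFormExtDeriv_chart P.θ_smooth he hy]
  rfl

/-- The witness is `J v`, carried to the chart: `dθ(v, J v) > 0`. -/
lemma chartExtDeriv_nondegenerate (P : PseudohermitianStructure n M)
    (he : e ∈ atlas (CRModel n) M) {y : CRModel n} (hy : y ∈ e.target) (v : CRModel n)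
    (hv : chartForm P.θ e y v = 0) (hv0 : v ≠ 0) :
    ∃ w, chartForm P.θ e y w = 0 ∧ chartExtDeriv P.θ e y v w ≠ 0 := by
  let v' : P.G (e.symm y) :=
    ⟨mfderiv 𝓘(ℝ, CRModel n) 𝓘(ℝ, CRModel n) e.symm y v, (P.mem_G_iff _ _).2 hv⟩
  have hv' : v' ≠ 0 := by
    intro h
    apply hv0
    rw [← mfderiv_mfderiv_symm he hy v]
    have : mfderiv 𝓘(ℝ, CRModel n) 𝓘(ℝ, CRModel n) e.symm y v = 0 := congrArg Subtype.val h
    rw [this, map_zero]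
    rfl
  have hpos := P.levi_pos _ v' hv'
  set u : CRTangent n (e.symm y) := (P.J _ v' : CRTangent n (e.symm y)) with hu
  have huG : P.θ (e.symm y) u = 0 := (P.mem_G_iff _ _).1 (P.J _ v').2
  refine ⟨mfderiv 𝓘(ℝ, CRModel n) 𝓘(ℝ, CRModel n) e (e.symm y) u, ?_, ?_⟩
  · change P.θ (e.symm y) (mfderiv 𝓘(ℝ, CRModel n) 𝓘(ℝ, CRModel n) e.symm y
      (mfderiv 𝓘(ℝ, CRModel n) 𝓘(ℝ, CRModel n) e (e.symm y) u)) = 0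
    rw [mfderiv_symm_mfderiv he hy, huG]
  · have h := oneFormExtDeriv_chart P.θ_smooth he hy v
      (mfderiv 𝓘(ℝ, CRModel n) 𝓘(ℝ, CRModel n) e (e.symm y) u)
    rw [mfderiv_symm_mfderiv he hy] at h
    rw [← h]
    exact hpos.ne'

lemma volumeForm_chart_ne_zero (P : PseudohermitianStructure n M) (he : e ∈ atlas (CRModel n) M)
    {y : CRModel n} (hy : y ∈ e.target) :
    P.volumeForm (e.symm y) (fun i => mfderiv 𝓘(ℝ, CRModel n) 𝓘(ℝ, CRModel n) e.symm y
      (EuclideanSpace.single i (1 : ℝ) : CRModel n)) ≠ 0 := by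
  rw [P.volumeForm_chart he hy]
  refine mul_ne_zero (by positivity) ?_
  have hθ := P.chartForm_ne_zero he hy
  have h := wedgePower_basis_ne_zero (n := n) (chartForm P.θ e y : CRModel n →ₗ[ℝ] ℝ)
    (chartExtDeriv P.θ e y) (fun v => by simp [chartExtDeriv_apply])
    (by
      have h1 := LinearMap.finrank_range_add_finrank_ker (chartForm P.θ e y : CRModel n →ₗ[ℝ] ℝ)
      have h2 := Submodule.finrank_le (LinearMap.range (chartForm P.θ e y : CRModel n →ₗ[ℝ] ℝ))
      rw [Module.finrank_self] at h2
      rw [finrank_euclideanSpace_fin] at h1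
      omega)
    (fun h => hθ (ContinuousLinearMap.coe_injective h))
    (fun v hv hv0 => by
      obtain ⟨w, hw, hvw⟩ := P.chartExtDeriv_nondegenerate he hy v hv hv0
      exact ⟨w, hw, hvw⟩)
    ((EuclideanSpace.basisFun (Fin (2 * n + 1)) ℝ).toBasis.reindex (slotEquiv n).symm)
  rw [wedgePower_apply] at h
  convert h using 1
  -- Relabelling the slots by `slotEquiv` conjugates the permutations and preserves their signs.
  refine (Fintype.sum_equiv (slotEquiv n).permCongr _ _ fun σ => ?_).symm
  rw [Equiv.Perm.sign_permCongr, mul_assoc]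
  have h0 : (slotEquiv n).symm 0 = none := by
    rw [Equiv.symm_apply_eq]; rfl
  have h1 : ∀ k : Fin n, (slotEquiv n).symm ⟨2 * k.1 + 1, by omega⟩ = some (k, false) := fun k => by
    rw [Equiv.symm_apply_eq]; rfl
  have h2 : ∀ k : Fin n, (slotEquiv n).symm ⟨2 * k.1 + 2, by omega⟩ = some (k, true) := fun k => by
    rw [Equiv.symm_apply_eq]; rfl
  simp [Equiv.permCongr_apply, h0, h1, h2]

lemma density_pos (P : PseudohermitianStructure n M) (he : e ∈ atlas (CRModel n) M)
    {y : CRModel n} (hy : y ∈ e.target) : 0 < P.density e y :=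
  abs_pos.2 (P.volumeForm_chart_ne_zero he hy)

/-- The absolute value is smooth away from zero, and the volume form has no zeros. -/
lemma contDiffOn_density (P : PseudohermitianStructure n M) (he : e ∈ atlas (CRModel n) M) :
    ContDiffOn ℝ 1 (P.density e) e.target := by
  have hsm : ContDiffOn ℝ 1 (fun y => P.volumeForm (e.symm y)
      (fun i => mfderiv 𝓘(ℝ, CRModel n) 𝓘(ℝ, CRModel n) e.symm y
        (EuclideanSpace.single i (1 : ℝ) : CRModel n))) e.target := by
    refine ContDiffOn.congr ?_ fun y hy => P.volumeForm_chart he hy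
    refine contDiffOn_const.mul (ContDiffOn.sum fun σ _ => (contDiffOn_const.mul ?_).mul
      (contDiffOn_prod fun k _ => contDiffOn_chartExtDeriv P.θ_smooth he subset_rfl e.open_target
        contDiffOn_const contDiffOn_const))
    exact ((P.θ_smooth e he).of_le (by norm_cast)).clm_apply contDiffOn_const
  exact hsm.abs fun y hy => P.volumeForm_chart_ne_zero he hy

end PseudohermitianStructure

/-- The pull-back of a covector to the target of a chart. -/
noncomputable def chartCovector {n : ℕ} {M : Type*} [TopologicalSpace M]
    [ChartedSpace (CRModel n) M] (e : OpenPartialHomeomorph M (CRModel n)) (y : CRModel n)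
    (α : CRTangent n (e.symm y) →L[ℝ] ℝ) : CRModel n →L[ℝ] ℝ :=
  α.comp (mfderiv 𝓘(ℝ, CRModel n) 𝓘(ℝ, CRModel n) e.symm y)

namespace PseudohermitianStructure

variable {n : ℕ} {M : Type*} [TopologicalSpace M] [ChartedSpace (CRModel n) M]
  [IsManifold 𝓘(ℝ, CRModel n) ∞ M] {e : OpenPartialHomeomorph M (CRModel n)}

/-- In a chart, `⟨α, β⟩_θ` times the density is a continuously differentiable bilinear form. -/
theorem exists_chart_symbol (P : PseudohermitianStructure n M) (he : e ∈ atlas (CRModel n) M)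
    {x₀ : M} (hx₀ : x₀ ∈ e.source) :
    ∃ (V : Set (CRModel n)) (B : CRModel n → (CRModel n →L[ℝ] ℝ) →L[ℝ] CRModel n),
      IsOpen V ∧ V ⊆ e.target ∧ e x₀ ∈ V ∧ ContDiffOn ℝ 1 B V ∧
      (∀ y ∈ V, ∀ α β : CRTangent n (e.symm y) →L[ℝ] ℝ,
        P.coInner (e.symm y) α β * P.density e y =
          chartCovector e y β (B y (chartCovector e y α))) ∧
      ∀ y ∈ V, ∀ γ : CRModel n →L[ℝ] ℝ, 0 ≤ γ (B y γ) := by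
  obtain ⟨U, X, Y, hU, hxU, hX, hY, hfr⟩ := P.frame x₀
  set V := e.target ∩ e.symm ⁻¹' U with hV
  have hVo : IsOpen V := e.symm.isOpen_inter_preimage hU
  have hVt : V ⊆ e.target := inter_subset_left
  let D : ∀ (Z : ∀ x : M, CRTangent n x) (y : CRModel n), CRModel n := fun Z y =>
    mfderiv 𝓘(ℝ, CRModel n) 𝓘(ℝ, CRModel n) e (e.symm y) (Z (e.symm y))
  have hD : ∀ Z, ∀ y ∈ V, mfderiv 𝓘(ℝ, CRModel n) 𝓘(ℝ, CRModel n) e.symm y (D Z y) =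
      Z (e.symm y) := fun Z y hy => mfderiv_symm_mfderiv he (hVt hy) _
  let E : Fin n ⊕ Fin n → CRModel n → CRModel n := Sum.elim (fun a => D (X a)) (fun a => D (Y a))
  -- `J X = Y` and `J Y = -X`, so `J` maps the frame to `C¹` fields; `J` itself comes only
  -- pointwise, and its smoothness is encoded in the frames.
  let JE : Fin n ⊕ Fin n → CRModel n → CRModel n :=
    Sum.elim (fun a => D (Y a)) (fun a y => - D (X a) y)
  have hE : ∀ a, ContDiffOn ℝ 1 (E a) V := by
    rintro (a | a)
    · exact contDiffOn_chart_vectorField he (hX a)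
    · exact contDiffOn_chart_vectorField he (hY a)
  have hJE : ∀ a, ContDiffOn ℝ 1 (JE a) V := by
    rintro (a | a)
    · exact contDiffOn_chart_vectorField he (hY a)
    · exact (contDiffOn_chart_vectorField he (hX a)).neg
  let g : CRModel n → Matrix (Fin n ⊕ Fin n) (Fin n ⊕ Fin n) ℝ := fun y =>
    Matrix.of fun a b => chartExtDeriv P.θ e y (E a y) (JE b y)
  have hg : ∀ a b, ContDiffOn ℝ 1 (fun y => g y a b) V := fun a b =>
    contDiffOn_chartExtDeriv P.θ_smooth he hVt hVo (hE a) (hJE b)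
  have hframe : ∀ y ∈ V, ∃ F : Fin n ⊕ Fin n → P.G (e.symm y), LinearIndependent ℝ F ∧
      Submodule.span ℝ (range F) = ⊤ ∧
      (∀ a, mfderiv 𝓘(ℝ, CRModel n) 𝓘(ℝ, CRModel n) e.symm y (E a y) = (F a).1) ∧
      g y = Matrix.of fun a b => P.levi (e.symm y) (F a) (F b) := by
    intro y hy
    obtain ⟨hJ, hli, hspan⟩ := hfr (e.symm y) hy.2
    have hmem : ∀ a, Sum.elim (fun a => X a (e.symm y)) (fun a => Y a (e.symm y)) a ∈
        P.G (e.symm y) := fun a => by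
      rw [← hspan]; exact Submodule.subset_span (mem_range_self a)
    let F : Fin n ⊕ Fin n → P.G (e.symm y) := fun a => ⟨_, hmem a⟩
    have hF : ∀ a, mfderiv 𝓘(ℝ, CRModel n) 𝓘(ℝ, CRModel n) e.symm y (E a y) = (F a).1 := by
      rintro (a | a)
      · exact hD (X a) y hy
      · exact hD (Y a) y hy
    have hJX : ∀ a, P.J _ (F (Sum.inl a)) = F (Sum.inr a) := fun a => by
      obtain ⟨h, hYa⟩ := hJ a
      exact Subtype.ext hYa.symm
    have hJF : ∀ a, mfderiv 𝓘(ℝ, CRModel n) 𝓘(ℝ, CRModel n) e.symm y (JE a y) =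
        (P.J _ (F a)).1 := by
      rintro (a | a)
      · rw [hJX]; exact hD (Y a) y hy
      · rw [← hJX, P.J_sq]
        exact (map_neg (mfderiv 𝓘(ℝ, CRModel n) 𝓘(ℝ, CRModel n) e.symm y) (D (X a) y)).trans
          (congrArg Neg.neg (hD (X a) y hy))
    refine ⟨F, ?_, ?_, hF, ?_⟩
    · exact LinearIndependent.of_comp (P.G (e.symm y)).subtype hli
    · refine Submodule.map_injective_of_injective (P.G (e.symm y)).injective_subtype ?_
      rw [Submodule.map_span, ← range_comp, Submodule.map_top, Submodule.range_subtype]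
      exact hspan
    · ext a b
      rw [Matrix.of_apply, P.levi_apply, ← hJF, ← hF, oneFormExtDeriv_chart P.θ_smooth he (hVt hy)]
      rfl
  have hdet : ∀ y ∈ V, (g y).det ≠ 0 := by
    intro y hy
    obtain ⟨F, hli, -, -, hgF⟩ := hframe y hy
    rw [hgF]
    exact P.gram_det_ne_zero _ hli
  -- In coordinates `B γ = ρ ∑ g^{ba} γ(E_a) E_b`, with `ρ` the density and `g` the Gram matrix of
  -- the frame.
  let B : CRModel n → (CRModel n →L[ℝ] ℝ) →L[ℝ] CRModel n := fun y =>
    ∑ b, ∑ a, (ContinuousLinearMap.apply ℝ ℝ (E a y)).smulRight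
      ((P.density e y * (g y)⁻¹ b a) • E b y)
  have hB : ∀ y ∈ V, ∀ α β : CRTangent n (e.symm y) →L[ℝ] ℝ,
      P.coInner (e.symm y) α β * P.density e y =
        chartCovector e y β (B y (chartCovector e y α)) := by
    intro y hy α β
    obtain ⟨F, hli, hspan, hF, hgF⟩ := hframe y hy
    have hα : ∀ (α : CRTangent n (e.symm y) →L[ℝ] ℝ) a, chartCovector e y α (E a y) = α (F a) :=
      fun α a => congrArg α (hF a)
    rw [P.coInner_eq_sum _ hli hspan, ← hgF]
    simp only [B, _root_.sum_apply, map_smul, map_sum,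
      ContinuousLinearMap.smulRight_apply, ContinuousLinearMap.apply_apply, smul_eq_mul, hα]
    rw [Finset.sum_mul]
    simp only [Finset.sum_mul]
    exact Finset.sum_congr rfl fun b _ => Finset.sum_congr rfl fun a _ => by ring
  refine ⟨V, B, hVo, hVt, ⟨e.map_source hx₀, by simpa [e.left_inv hx₀] using hxU⟩, ?_, hB, ?_⟩
  · exact contDiffOn_sum_smulRight ((P.contDiffOn_density he).mono hVt)
      (contDiffOn_matrix_inv hg hdet) hE
  · intro y hy γ
    -- Every covector of the model space is the pull-back of one on `M`, so nonnegativity is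
    -- inherited from `⟨·, ·⟩_θ`.
    have hγ : chartCovector e y
        (γ.comp (mfderiv 𝓘(ℝ, CRModel n) 𝓘(ℝ, CRModel n) e (e.symm y))) = γ := by
      ext v
      exact congrArg γ (mfderiv_mfderiv_symm he (hVt hy) v)
    rw [← hγ, ← hB y hy]
    exact mul_nonneg (P.coInner_self_nonneg _ _) (P.density_pos he (hVt hy)).le

end PseudohermitianStructure

/-! ### Divergence-form operators on Euclidean space -/

section Euclidean

variable {ι : Type*} [Fintype ι] [DecidableEq ι]

/-- The divergence of a vector field on `ℝ^ι`. -/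
noncomputable def divergence (b : EuclideanSpace ℝ ι → EuclideanSpace ℝ ι)
    (y : EuclideanSpace ℝ ι) : ℝ :=
  ∑ i, fderiv ℝ b y (EuclideanSpace.single i 1) i

open scoped MatrixOrder in
/-- The trace of the product of a nonnegative and a nonpositive bilinear form is nonpositive. -/
lemma trace_symbol_hessian_nonpos
    (B : (EuclideanSpace ℝ ι →L[ℝ] ℝ) →L[ℝ] EuclideanSpace ℝ ι)
    (hB : ∀ γ : EuclideanSpace ℝ ι →L[ℝ] ℝ, 0 ≤ γ (B γ))
    (H : EuclideanSpace ℝ ι →L[ℝ] EuclideanSpace ℝ ι →L[ℝ] ℝ) (hsymm : ∀ v w, H v w = H w v)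
    (hH : ∀ v, H v v ≤ 0) :
    ∑ i, B (H (EuclideanSpace.single i 1)) i ≤ 0 := by
  let h : Matrix ι ι ℝ := Matrix.of fun i j =>
    - H (EuclideanSpace.single i 1) (EuclideanSpace.single j 1)
  have hsum : ∀ v : EuclideanSpace ℝ ι, v = ∑ i, v i • EuclideanSpace.single i (1 : ℝ) := fun v => by
    have := (EuclideanSpace.basisFun ι ℝ).sum_repr v
    simpa using this.symm
  have hpsd : h.PosSemidef := by
    refine Matrix.PosSemidef.of_dotProduct_mulVec_nonneg ?_ fun x => ?_
    · ext i j
      simp [h, hsymm (EuclideanSpace.single j 1)]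
    · have hx := hH (∑ i, x i • EuclideanSpace.single i (1 : ℝ))
      simp only [map_sum, map_smul, _root_.sum_apply, _root_.smul_apply, smul_eq_mul] at hx
      simp only [star_trivial, dotProduct, Matrix.mulVec, h, Matrix.of_apply]
      have : ∑ i, x i * ∑ j, -H (EuclideanSpace.single i 1) (EuclideanSpace.single j 1) * x j =
          -∑ i, x i * ∑ j, x j * H (EuclideanSpace.single j 1) (EuclideanSpace.single i 1) := by
        rw [← Finset.sum_neg_distrib]
        refine Finset.sum_congr rfl fun i _ => ?_
        rw [← mul_neg, ← Finset.sum_neg_distrib]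
        congr 1
        refine Finset.sum_congr rfl fun j _ => ?_
        rw [hsymm (EuclideanSpace.single j 1)]; ring
      rw [this]
      linarith
  -- Writing `-H = Cᵀ C` makes `-H` a sum of squares of covectors `γ k`, and the trace becomes `-∑ γ
  -- k (B (γ k))`. Hence `B` need not be symmetric.
  obtain ⟨C, hC⟩ := CStarAlgebra.nonneg_iff_eq_star_mul_self.mp hpsd.nonneg
  let γ : ι → EuclideanSpace ℝ ι →L[ℝ] ℝ := fun k => ∑ j, C k j • EuclideanSpace.proj j
  have hHγ : ∀ i, H (EuclideanSpace.single i 1) = -∑ k, C k i • γ k := by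
    intro i
    ext v
    rw [hsum v]
    simp only [map_sum, map_smul, smul_eq_mul]
    refine Finset.sum_congr rfl fun j _ => ?_
    congr 1
    have hij : h i j = ∑ k, C k i * C k j := by
      rw [hC, Matrix.star_eq_conjTranspose, Matrix.mul_apply]; simp
    have hij' : H (EuclideanSpace.single i 1) (EuclideanSpace.single j 1) = - h i j := by simp [h]
    rw [hij', hij]
    simp [γ]
  have hfinal : ∑ i, B (H (EuclideanSpace.single i 1)) i = -∑ k, γ k (B (γ k)) := by
    simp only [hHγ, map_neg, map_sum, map_smul, PiLp.neg_apply, Finset.sum_neg_distrib]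
    congr 1
    have h1 : ∀ i, (∑ k, C k i • B (γ k)).ofLp i = ∑ k, C k i * B (γ k) i := fun i => by simp
    simp only [h1]
    rw [Finset.sum_comm]
    have h2 : ∀ k v, γ k v = ∑ j, C k j * v j := fun k v => by simp [γ]
    exact Finset.sum_congr rfl fun k _ => (h2 k _).symm
  rw [hfinal]
  exact neg_nonpos.2 (Finset.sum_nonneg fun k _ => hB _)

/-- The divergence theorem for the product of a vector field and a test function. -/
lemma integral_fderiv_apply_eq_neg_integral_divergence
    {b : EuclideanSpace ℝ ι → EuclideanSpace ℝ ι} {V : Set (EuclideanSpace ℝ ι)} (hV : IsOpen V)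
    (hb : ContDiffOn ℝ 1 b V) {φ : EuclideanSpace ℝ ι → ℝ} (hφ : ContDiff ℝ ∞ φ)
    (hc : HasCompactSupport φ) (hs : tsupport φ ⊆ V) :
    ∫ y, fderiv ℝ φ y (b y) = -∫ y, divergence b y * φ y := by
  have hbd : ∀ y ∈ V, DifferentiableAt ℝ b y := fun y hy =>
    (hb.contDiffAt (hV.mem_nhds hy)).differentiableAt (by simp)
  have hbi : ∀ i, ∀ y ∈ V, HasFDerivAt (fun y => b y i)
      ((EuclideanSpace.proj i).comp (fderiv ℝ b y)) y := fun i y hy =>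
    (EuclideanSpace.proj (𝕜 := ℝ) i).hasFDerivAt.comp y (hbd y hy).hasFDerivAt
  have hbcont : ∀ i, ContinuousOn (fun y => b y i) V := fun i =>
    (EuclideanSpace.proj (𝕜 := ℝ) i).continuous.comp_continuousOn hb.continuousOn
  have hfb : ContinuousOn (fderiv ℝ b) V := hb.continuousOn_fderiv_of_isOpen hV le_rfl
  have hdcont : ∀ i, ContinuousOn (fun y => fderiv ℝ b y (EuclideanSpace.single i 1) i) V := fun i =>
    (EuclideanSpace.proj (𝕜 := ℝ) i).continuous.comp_continuousOn (hfb.clm_apply continuousOn_const)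
  have hφd : ∀ v, Continuous fun y => fderiv ℝ φ y v := fun v =>
    (hφ.continuous_fderiv (by simp)).clm_apply continuous_const
  have hφds : ∀ v, tsupport (fun y => fderiv ℝ φ y v) ⊆ V := fun v =>
    (closure_minimal ((fun y hy => support_fderiv_subset ℝ fun h => hy (by simp [h])) :
      Function.support (fun y => fderiv ℝ φ y v) ⊆ tsupport φ) (isClosed_tsupport φ)).trans hs
  have key : ∀ {f g : EuclideanSpace ℝ ι → ℝ}, ContinuousOn f V → Continuous g →
      HasCompactSupport g → tsupport g ⊆ V → Integrable fun y => f y * g y := by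
    intro f g hf hg hgc hgs
    refine Continuous.integrable_of_hasCompactSupport ?_ hgc.mul_left
    exact ContinuousOn.continuous_of_tsupport_subset (hf.mul hg.continuousOn) hV
      ((tsupport_mul_subset_right).trans hgs)
  have int1 : ∀ i, Integrable fun y => b y i * fderiv ℝ φ y (EuclideanSpace.single i 1) := fun i =>
    key (hbcont i) (hφd _) (hc.fderiv_apply ℝ _) (hφds _)
  have int2 : ∀ i, Integrable fun y => fderiv ℝ b y (EuclideanSpace.single i 1) i * φ y := fun i =>
    key (hdcont i) hφ.continuous hc hs
  have hpart : ∀ i, ∫ y, b y i * fderiv ℝ φ y (EuclideanSpace.single i 1) =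
      -∫ y, fderiv ℝ b y (EuclideanSpace.single i 1) i * φ y := by
    intro i
    -- Outside `V` nothing is known about the differentiability of `b`, but there `φ = 0`.
    have heq : ∀ y, fderiv ℝ (fun y => b y i) y (EuclideanSpace.single i 1) * φ y =
        fderiv ℝ b y (EuclideanSpace.single i 1) i * φ y := by
      intro y
      by_cases hy : y ∈ V
      · rw [(hbi i y hy).fderiv]; rfl
      · rw [image_eq_zero_of_notMem_tsupport fun h => hy (hs h)]; simp
    rw [integral_mul_fderiv_eq_neg_fderiv_mul_of_integrable]
    · simp only [heq]
    · simpa only [heq] using int2 i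
    · exact int1 i
    · exact key (hbcont i) hφ.continuous hc hs
    · exact fun y hy => (hbi i y (hs hy)).differentiableAt
    · exact fun y _ => hφ.differentiable (by simp) y
  have hexp : ∀ y, fderiv ℝ φ y (b y) = ∑ i, b y i * fderiv ℝ φ y (EuclideanSpace.single i 1) := by
    intro y
    conv_lhs => rw [← (EuclideanSpace.basisFun ι ℝ).sum_repr (b y)]
    simp
  simp only [hexp, divergence, Finset.sum_mul]
  rw [integral_finsetSum _ fun i _ => int1 i, integral_finsetSum _ fun i _ => int2 i,
    ← Finset.sum_neg_distrib]
  exact Finset.sum_congr rfl fun i _ => hpart i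

lemma continuousOn_divergence {b : EuclideanSpace ℝ ι → EuclideanSpace ℝ ι}
    {V : Set (EuclideanSpace ℝ ι)} (hV : IsOpen V) (hb : ContDiffOn ℝ 1 b V) :
    ContinuousOn (divergence b) V := by
  refine continuousOn_finsetSum _ fun i _ => ?_
  exact (EuclideanSpace.proj (𝕜 := ℝ) i).continuous.comp_continuousOn
    ((hb.continuousOn_fderiv_of_isOpen hV le_rfl).clm_apply continuousOn_const)

/-- A continuous function is the divergence of a vector field if it is so in the weak sense. -/
lemma eqOn_divergence_of_weak {b : EuclideanSpace ℝ ι → EuclideanSpace ℝ ι}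
    {V : Set (EuclideanSpace ℝ ι)} (hV : IsOpen V) (hb : ContDiffOn ℝ 1 b V)
    {f : EuclideanSpace ℝ ι → ℝ} (hf : ContinuousOn f V)
    (hweak : ∀ φ : EuclideanSpace ℝ ι → ℝ, ContDiff ℝ ∞ φ → HasCompactSupport φ →
      tsupport φ ⊆ V → ∫ y, f y * φ y = -∫ y, fderiv ℝ φ y (b y)) :
    EqOn f (divergence b) V := by
  have hd := continuousOn_divergence hV hb
  have h0 : ∀ᵐ y ∂(volume : Measure (EuclideanSpace ℝ ι)), y ∈ V → f y - divergence b y = 0 := by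
    refine hV.ae_eq_zero_of_integral_contDiff_smul_eq_zero
      ((hf.sub hd).locallyIntegrableOn hV.measurableSet) fun φ hφ hc hs => ?_
    have hint : ∀ {g : EuclideanSpace ℝ ι → ℝ}, ContinuousOn g V → Integrable fun y => g y * φ y := by
      intro g hg
      refine Continuous.integrable_of_hasCompactSupport ?_ hc.mul_left
      exact ContinuousOn.continuous_of_tsupport_subset (hg.mul hφ.continuous.continuousOn) hV
        ((tsupport_mul_subset_right).trans hs)
    have : ∀ y, φ y • (f y - divergence b y) = f y * φ y - divergence b y * φ y := fun y => by
      rw [smul_eq_mul]; ring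
    simp only [this]
    rw [integral_sub (hint hf) (hint hd), hweak φ hφ hc hs,
      integral_fderiv_apply_eq_neg_integral_divergence hV hb hφ hc hs]
    ring
  -- Equality almost everywhere improves to equality everywhere on the open set `V` because both
  -- sides are continuous.
  refine Measure.eqOn_open_of_ae_eq (μ := volume) ?_ hV hf hd
  rw [EventuallyEq, ae_restrict_iff' hV.measurableSet]
  filter_upwards [h0] with y hy hyV
  exact sub_eq_zero.1 (hy hyV)

end Euclidean

/-- The Hessian is nonpositive at a local maximum. -/
lemma fderiv_fderiv_apply_self_nonpos_of_isLocalMax {E : Type*} [NormedAddCommGroup E]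
    [NormedSpace ℝ E] {f : E → ℝ} {y : E} (hf : ContDiffAt ℝ 2 f y) (hmax : IsLocalMax f y) (v : E) :
    fderiv ℝ (fderiv ℝ f) y v v ≤ 0 := by
  by_contra! hpos
  let l : ℝ → E := fun t => y + t • v
  have hl0 : l 0 = y := by simp [l]
  have hl : ∀ t, HasDerivAt l v t := fun t => by
    have := ((hasDerivAt_id t).smul_const v).const_add y
    rwa [one_smul] at this
  have hlc : Tendsto l (𝓝 0) (𝓝 y) := by
    have := (hl 0).continuousAt.tendsto
    rwa [hl0] at this
  have hderiv : deriv (f ∘ l) =ᶠ[𝓝 0] fun t => fderiv ℝ f (l t) v := by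
    filter_upwards [hlc.eventually (hf.eventually (by simp))] with t ht
    exact ((ht.differentiableAt (by simp)).hasFDerivAt.comp_hasDerivAt t (hl t)).deriv
  have hf2 : DifferentiableAt ℝ (fderiv ℝ f) y :=
    (hf.fderiv_right (m := 1) (by norm_num)).differentiableAt (by simp)
  have h2 : deriv (deriv (f ∘ l)) 0 = fderiv ℝ (fderiv ℝ f) y v v := by
    rw [hderiv.deriv_eq]
    have h := (hl0.symm ▸ hf2.hasFDerivAt :
      HasFDerivAt (fderiv ℝ f) (fderiv ℝ (fderiv ℝ f) y) (l 0)).comp_hasDerivAt 0 (hl 0)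
    exact (h.clm_apply (hasDerivAt_const (0 : ℝ) v)).deriv.trans (by simp)
  have hmaxl : IsLocalMax (f ∘ l) 0 := by
    have : ∀ᶠ t in 𝓝 (0 : ℝ), f (l t) ≤ f y := hlc.eventually hmax
    filter_upwards [this] with t ht
    simpa [hl0] using ht
  have hcont : ContinuousAt (f ∘ l) 0 := by
    refine ContinuousAt.comp ?_ (hl 0).continuousAt
    rw [hl0]; exact hf.continuousAt
  -- A positive second derivative makes `0` a local minimum along the line as well, so `f ∘ l` is
  -- locally constant and its second derivative vanishes, a contradiction.
  have hminl : IsLocalMin (f ∘ l) 0 :=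
    isLocalMin_of_deriv_deriv_pos (by rw [h2]; exact hpos) hmaxl.deriv_eq_zero hcont
  have hconst : f ∘ l =ᶠ[𝓝 0] fun _ => f y := by
    filter_upwards [hmaxl, hminl] with t h1 h2
    rw [← hl0]
    exact le_antisymm h1 h2
  have hd0 : deriv (f ∘ l) =ᶠ[𝓝 0] fun _ => 0 := by
    filter_upwards [hconst.eventuallyEq_nhds] with t ht
    rw [ht.deriv_eq, deriv_const]
  rw [hd0.deriv_eq, deriv_const] at h2
  linarith

/-! ### Transplanting test functions to the manifold -/

section ChartFunctions

variable {n : ℕ} {M : Type*} [TopologicalSpace M] {e : OpenPartialHomeomorph M (CRModel n)}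

/-- The extension by zero of a function on the target of a chart. -/
noncomputable def chartExtension (e : OpenPartialHomeomorph M (CRModel n)) (φ : CRModel n → ℝ) :
    M → ℝ := e.source.indicator (φ ∘ e)

lemma chartExtension_symm {φ : CRModel n → ℝ} {y : CRModel n} (hy : y ∈ e.target) :
    chartExtension e φ (e.symm y) = φ y := by
  rw [chartExtension, indicator_of_mem (e.map_target hy), Function.comp_apply, e.right_inv hy]

/-- The compact image of the support is closed because `M` is Hausdorff, so extension by zero adds
no support points at the edge of the chart. -/
lemma tsupport_chartExtension_subset [T2Space M] {φ : CRModel n → ℝ} (hc : HasCompactSupport φ)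
    (hs : tsupport φ ⊆ e.target) :
    IsCompact (e.symm '' tsupport φ) ∧ tsupport (chartExtension e φ) ⊆ e.symm '' tsupport φ := by
  have hK : IsCompact (e.symm '' tsupport φ) :=
    hc.isCompact.image_of_continuousOn (e.continuousOn_symm.mono hs)
  refine ⟨hK, closure_minimal ?_ hK.isClosed⟩
  intro x hx
  by_cases hxs : x ∈ e.source
  · rw [Function.mem_support, chartExtension, indicator_of_mem hxs] at hx
    exact ⟨e x, subset_tsupport _ hx, e.left_inv hxs⟩
  · exact absurd (indicator_of_notMem hxs _) hx

variable [ChartedSpace (CRModel n) M] [IsManifold 𝓘(ℝ, CRModel n) ∞ M]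

lemma contDiffOn_comp_chart_symm (he : e ∈ atlas (CRModel n) M) {w : M → ℝ}
    (hw : ContMDiff 𝓘(ℝ, CRModel n) 𝓘(ℝ, ℝ) 2 w) : ContDiffOn ℝ 2 (w ∘ e.symm) e.target := by
  rw [← contMDiffOn_iff_contDiffOn]
  exact hw.comp_contMDiffOn ((contMDiffOn_atlas_symm he).of_le (by norm_cast))

lemma chartCovector_differential (he : e ∈ atlas (CRModel n) M) {y : CRModel n}
    (hy : y ∈ e.target) {w : M → ℝ}
    (hw : MDifferentiableAt 𝓘(ℝ, CRModel n) 𝓘(ℝ, ℝ) w (e.symm y)) :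
    chartCovector e y (differential n w (e.symm y)) = fderiv ℝ (w ∘ e.symm) y := by
  rw [← mfderiv_eq_fderiv, mfderiv_comp y hw ((atlas_mdifferentiable he).mdifferentiableAt_symm hy)]
  rfl

lemma contMDiff_chartExtension [T2Space M] (he : e ∈ atlas (CRModel n) M) {φ : CRModel n → ℝ}
    (hφ : ContDiff ℝ ∞ φ) (hc : HasCompactSupport φ) (hs : tsupport φ ⊆ e.target) :
    ContMDiff 𝓘(ℝ, CRModel n) 𝓘(ℝ, ℝ) ∞ (chartExtension e φ) := by
  refine contMDiff_of_tsupport fun x hx => ?_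
  obtain ⟨y, hy, rfl⟩ := (tsupport_chartExtension_subset hc hs).2 hx
  have hxs := e.map_target (hs hy)
  have h1 : ContMDiffAt 𝓘(ℝ, CRModel n) 𝓘(ℝ, ℝ) ∞ (φ ∘ e) (e.symm y) :=
    hφ.contMDiff.contMDiffAt.comp _
      ((contMDiffOn_atlas he).contMDiffAt (e.open_source.mem_nhds hxs))
  refine h1.congr_of_eventuallyEq ?_
  filter_upwards [e.open_source.mem_nhds hxs] with z hz
  exact indicator_of_mem hz _

end ChartFunctions

/-! ### The sub-Laplacian at a local maximum -/

namespace PseudohermitianStructure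

variable {n : ℕ} {M : Type*} [TopologicalSpace M] [T2Space M] [ChartedSpace (CRModel n) M]
  [IsManifold 𝓘(ℝ, CRModel n) ∞ M] {e : OpenPartialHomeomorph M (CRModel n)}

omit [T2Space M] in
lemma coInner_zero_right (P : PseudohermitianStructure n M) (x : M)
    (α : CRTangent n x →L[ℝ] ℝ) : P.coInner x α 0 = 0 := by
  have h : P.sharp x 0 = 0 := by
    apply P.levi_injective x
    ext w
    rw [P.levi_sharp]
    simp
  rw [coInner, h, map_zero]

/-- The sub-Laplacian in divergence form in a chart. -/
theorem IsSubLaplacian.eqOn_divergence {P : PseudohermitianStructure n M}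
    (he : e ∈ atlas (CRModel n) M) {V : Set (CRModel n)}
    {B : CRModel n → (CRModel n →L[ℝ] ℝ) →L[ℝ] CRModel n} (hVo : IsOpen V) (hVt : V ⊆ e.target)
    (hBs : ContDiffOn ℝ 1 B V)
    (hB : ∀ y ∈ V, ∀ α β : CRTangent n (e.symm y) →L[ℝ] ℝ,
      P.coInner (e.symm y) α β * P.density e y = chartCovector e y β (B y (chartCovector e y α)))
    {w Lw : M → ℝ} (hw : ContMDiff 𝓘(ℝ, CRModel n) 𝓘(ℝ, ℝ) 2 w) (hL : P.IsSubLaplacian w Lw) :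
    EqOn (fun y => Lw (e.symm y) * P.density e y)
      (divergence fun y => B y (fderiv ℝ (w ∘ e.symm) y)) V := by
  have hw2 := contDiffOn_comp_chart_symm he hw
  have hb : ContDiffOn ℝ 1 (fun y => B y (fderiv ℝ (w ∘ e.symm) y)) V :=
    hBs.clm_apply ((hw2.mono hVt).fderiv_of_isOpen hVo (by norm_num))
  refine eqOn_divergence_of_weak hVo hb ?_ fun φ hφ hc hs => ?_
  · exact ((hL.1.comp_continuousOn e.continuousOn_symm).mono hVt).mul
      ((P.contDiffOn_density he).continuousOn.mono hVt)
  have hst := hs.trans hVt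
  obtain ⟨hK, hKs⟩ := tsupport_chartExtension_subset (e := e) hc hst
  have hsm := contMDiff_chartExtension he hφ hc hst
  have hweak := hL.2 e he _ hsm (hK.of_isClosed_subset (isClosed_tsupport _) hKs)
    (hKs.trans (by rintro _ ⟨y, hy, rfl⟩; exact e.map_target (hst hy)))
  have h0 : ∀ y ∉ e.target, φ y = 0 := fun y hy =>
    image_eq_zero_of_notMem_tsupport fun h => hy (hst h)
  have h1 : ∀ y ∉ tsupport φ, fderiv ℝ φ y = 0 := fun y hy => by
    by_contra h
    exact hy (support_fderiv_subset ℝ h)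
  have hleft : P.chartIntegral e (fun x => Lw x * chartExtension e φ x) =
      ∫ y, Lw (e.symm y) * P.density e y * φ y := by
    refine Eq.trans ?_ (setIntegral_eq_integral_of_forall_compl_eq_zero (s := e.target)
      (fun y hy => by rw [h0 y hy, mul_zero]))
    refine setIntegral_congr_fun e.open_target.measurableSet fun y hy => ?_
    simp only [chartExtension_symm hy]
    ring
  have hright : P.chartIntegral e (fun x => P.coInner x (differential n w x)
      (differential n (chartExtension e φ) x)) =
      ∫ y, fderiv ℝ φ y (B y (fderiv ℝ (w ∘ e.symm) y)) := by
    refine Eq.trans ?_ (setIntegral_eq_integral_of_forall_compl_eq_zero (s := e.target)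
      (fun y hy => by rw [h1 y fun h => hy (hst h)]; rfl))
    refine setIntegral_congr_fun e.open_target.measurableSet fun y hy => ?_
    simp only
    have hdiff : chartCovector e y (differential n (chartExtension e φ) (e.symm y)) =
        fderiv ℝ φ y := by
      rw [chartCovector_differential he hy (hsm.mdifferentiableAt (by simp))]
      refine Filter.EventuallyEq.fderiv_eq ?_
      filter_upwards [e.open_target.mem_nhds hy] with z hz
      exact chartExtension_symm hz
    -- The formula for `B` holds only on `V`; on the rest of the chart `dφ = 0` and both integrands
    -- vanish.
    by_cases hyV : y ∈ V
    · rw [hB y hyV, hdiff, chartCovector_differential he hy (hw.mdifferentiableAt (by simp))]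
    · have hyφ := h1 y fun h => hyV (hs h)
      have hz : differential n (chartExtension e φ) (e.symm y) = 0 := by
        ext v
        rw [← mfderiv_symm_mfderiv he hy v]
        exact congrArg (fun L => L (mfderiv 𝓘(ℝ, CRModel n) 𝓘(ℝ, CRModel n) e (e.symm y) v))
          (hdiff.trans hyφ)
      rw [hz, P.coInner_zero_right, hyφ, zero_mul]
      rfl
  rw [hleft, hright] at hweak
  exact hweak

/-- The sub-Laplacian of a linear combination is nonpositive at its local maxima. -/
theorem IsSubLaplacian.combination_nonpos_of_isLocalMax {P : PseudohermitianStructure n M}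
    {w₁ w₂ L₁ L₂ : M → ℝ} (hw₁ : ContMDiff 𝓘(ℝ, CRModel n) 𝓘(ℝ, ℝ) 2 w₁)
    (hw₂ : ContMDiff 𝓘(ℝ, CRModel n) 𝓘(ℝ, ℝ) 2 w₂) (hL₁ : P.IsSubLaplacian w₁ L₁)
    (hL₂ : P.IsSubLaplacian w₂ L₂) (a c : ℝ) {x₀ : M}
    (hmax : IsLocalMax (fun x => a * w₁ x + c * w₂ x) x₀) : a * L₁ x₀ + c * L₂ x₀ ≤ 0 := by
  set e := chartAt (CRModel n) x₀
  have he : e ∈ atlas (CRModel n) M := chart_mem_atlas _ _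
  have hx₀ : x₀ ∈ e.source := mem_chart_source _ _
  obtain ⟨V, B, hVo, hVt, hyV, hBs, hB, hBpos⟩ := P.exists_chart_symbol he hx₀
  set y := e x₀ with hy
  have hyx : e.symm y = x₀ := e.left_inv hx₀
  set W₁ := w₁ ∘ e.symm
  set W₂ := w₂ ∘ e.symm
  have h₁ := (contDiffOn_comp_chart_symm he hw₁).mono hVt
  have h₂ := (contDiffOn_comp_chart_symm he hw₂).mono hVt
  have hd₁ := hL₁.eqOn_divergence he hVo hVt hBs hB hw₁ hyV
  have hd₂ := hL₂.eqOn_divergence he hVo hVt hBs hB hw₂ hyV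
  simp only [hyx] at hd₁ hd₂
  let W : CRModel n → ℝ := fun z => a * W₁ z + c * W₂ z
  have hW : ContDiffOn ℝ 2 W V := (contDiffOn_const.mul h₁).add (contDiffOn_const.mul h₂)
  have hWmax : IsLocalMax W y := by
    have hc : Tendsto e.symm (𝓝 y) (𝓝 x₀) := by
      have := (e.continuousAt_symm (e.map_source hx₀)).tendsto
      rwa [hyx] at this
    have := hc.eventually hmax
    filter_upwards [this] with z hz
    simpa [W, W₁, W₂, hyx] using hz
  have hdW : ∀ z ∈ V, fderiv ℝ W z = a • fderiv ℝ W₁ z + c • fderiv ℝ W₂ z := by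
    intro z hz
    have d₁ := (h₁.contDiffAt (hVo.mem_nhds hz)).differentiableAt (by simp)
    have d₂ := (h₂.contDiffAt (hVo.mem_nhds hz)).differentiableAt (by simp)
    exact ((d₁.hasFDerivAt.const_mul a).add (d₂.hasFDerivAt.const_mul c)).fderiv
  have hB1 : DifferentiableAt ℝ B y :=
    (hBs.contDiffAt (hVo.mem_nhds hyV)).differentiableAt (by simp)
  have hdd : ∀ {U : CRModel n → ℝ}, ContDiffOn ℝ 2 U V → DifferentiableAt ℝ (fderiv ℝ U) y :=
    fun hU => ((hU.fderiv_of_isOpen hVo (m := 1) (by norm_num)).contDiffAt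
      (hVo.mem_nhds hyV)).differentiableAt (by simp)
  -- Linearity is taken from the divergence form, so no sub-Laplacian of the combination itself has
  -- to be produced.
  have hlin : divergence (fun z => B z (fderiv ℝ W z)) y =
      a * divergence (fun z => B z (fderiv ℝ W₁ z)) y +
        c * divergence (fun z => B z (fderiv ℝ W₂ z)) y := by
    have hev : (fun z => B z (fderiv ℝ W z)) =ᶠ[𝓝 y]
        fun z => a • B z (fderiv ℝ W₁ z) + c • B z (fderiv ℝ W₂ z) := by
      filter_upwards [hVo.mem_nhds hyV] with z hz
      rw [hdW z hz, map_add, map_smul, map_smul]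
    have hfd := (((hB1.clm_apply (hdd h₁)).hasFDerivAt.const_smul a).add
      ((hB1.clm_apply (hdd h₂)).hasFDerivAt.const_smul c)).fderiv
    simp only [divergence, hev.fderiv_eq, Finset.mul_sum, ← Finset.sum_add_distrib]
    refine Finset.sum_congr rfl fun i _ => ?_
    exact congrArg (fun L : CRModel n →L[ℝ] CRModel n => L (EuclideanSpace.single i 1) i) hfd
  have hWy := hW.contDiffAt (hVo.mem_nhds hyV)
  have hdiv : divergence (fun z => B z (fderiv ℝ W z)) y =
      ∑ i, B y (fderiv ℝ (fderiv ℝ W) y (EuclideanSpace.single i 1)) i := by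
    simp only [divergence]
    refine Finset.sum_congr rfl fun i _ => ?_
    -- At the maximum `dW = 0`, which removes the term containing the derivative of `B`.
    rw [fderiv_clm_apply hB1 (hdd hW), hWmax.fderiv_eq_zero]
    simp
  have hneg := trace_symbol_hessian_nonpos (B y) (hBpos y hyV) (fderiv ℝ (fderiv ℝ W) y)
    (fun v w => (hWy.isSymmSndFDerivAt (by simp)).eq v w)
    (fderiv_fderiv_apply_self_nonpos_of_isLocalMax hWy hWmax)
  rw [← hdiv, hlin, ← hd₁, ← hd₂] at hneg
  have hρ := P.density_pos he (hVt hyV)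
  by_contra! hpos
  have := mul_pos hpos hρ
  linarith

end PseudohermitianStructure

/-! ### The parabolic maximum principle -/

/-- At a maximum over `[0, T]` the derivative is nonnegative, except at the initial time. -/
lemma hasDerivWithinAt_nonneg_of_isMaxOn {g : ℝ → ℝ} {g' T t₀ : ℝ} (ht₀ : t₀ ∈ Icc 0 T)
    (hpos : 0 < t₀) (hg : HasDerivWithinAt g g' (Icc 0 T) t₀) (hmax : IsMaxOn g (Icc 0 T) t₀) :
    0 ≤ g' := by
  -- The backward direction is admissible even at `t₀ = T`.
  have hcone : (0 : ℝ) - t₀ ∈ posTangentConeAt (Icc 0 T) t₀ :=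
    sub_mem_posTangentConeAt_of_segment_subset
      ((convex_Icc 0 T).segment_subset ht₀ ⟨le_rfl, ht₀.1.trans ht₀.2⟩)
  have h := hmax.localize.hasFDerivWithinAt_nonpos hg.hasFDerivWithinAt hcone
  simp only [ContinuousLinearMap.toSpanSingleton_apply, smul_eq_mul] at h
  nlinarith

theorem theorem4p1 (n : ℕ) (M : Type*) [TopologicalSpace M] [T2Space M]
    [SecondCountableTopology M] [ChartedSpace (CRModel n) M]
    [IsManifold 𝓘(ℝ, CRModel n) ∞ M] [NoncompactSpace M]
    (P : PseudohermitianStructure n M) (hcomplete : P.IsComplete) (hA : P.ConditionA)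
    (T : ℝ) (hT : 0 < T) (C : ℝ) (hC : 0 < C)
    (u : M → ℝ → ℝ)
    (hu : ContMDiffOn (𝓘(ℝ, CRModel n).prod 𝓘(ℝ, ℝ)) 𝓘(ℝ, ℝ) 2
      (fun p : M × ℝ => u p.1 p.2) (univ ×ˢ Icc 0 T))
    (Lu : M → ℝ → ℝ)
    (hLu : ∀ t ∈ Icc 0 T, P.IsSubLaplacian (fun x => u x t) (fun x => Lu x t))
    (F : ∀ x : M, (CRTangent n x →L[ℝ] ℝ) → ℝ → ℝ → ℝ)
    (hevol : ∀ x : M, ∀ t ∈ Icc 0 T,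
      HasDerivWithinAt (fun s => u x s)
        (Lu x t + F x (differential n (fun y => u y t) x) (u x t) t) (Icc 0 T) t)
    (hbound : ∀ x : M, ∀ t ∈ Icc 0 T, |u x t| ≤ C)
    (hinit : ∀ x : M, u x 0 ≤ 0)
    (hF : ∀ x : M, ∀ t ∈ Icc 0 T, 0 < u x t →
      F x (differential n (fun y => u y t) x) (u x t) t ≤ C * u x t) :
    ∀ x : M, ∀ t ∈ Icc 0 T, u x t ≤ 0 := by
  obtain ⟨A, f, Lf, hf, hfpos, hftends, hLf, hgrad, hLfA⟩ := hA
  have hslice : ∀ t ∈ Icc 0 T, ContMDiff 𝓘(ℝ, CRModel n) 𝓘(ℝ, ℝ) 2 fun x => u x t := by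
    intro t ht
    rw [← contMDiffOn_univ]
    exact hu.comp (contMDiff_id.prodMk contMDiff_const).contMDiffOn (fun x _ => ⟨mem_univ x, ht⟩)
  have main : ∀ ε > 0, ∀ x : M, ∀ t ∈ Icc 0 T,
      Real.exp (-C * t) * u x t - ε * f x - ε * (A + 1) * t ≤ 0 := by
    intro ε hε
    let v : M → ℝ → ℝ := fun x t => Real.exp (-C * t) * u x t - ε * f x - ε * (A + 1) * t
    change ∀ x : M, ∀ t ∈ Icc 0 T, v x t ≤ 0
    by_contra! hcon
    obtain ⟨x₁, t₁, ht₁, hv₁⟩ := hcon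
    -- Beyond this level `ε (f + (A + 1) t) > C ≥ e^{-Ct} u` for all `t ∈ [0, T]`, whatever the sign
    -- of `A + 1`.
    obtain ⟨K, hK, hKf⟩ := mem_cocompact.1 (hftends.eventually_gt_atTop (C / ε + |A + 1| * T))
    have hout : ∀ x ∉ K, ∀ t ∈ Icc 0 T, v x t ≤ 0 := by
      intro x hx t ht
      have h1 : C / ε + |A + 1| * T < f x := hKf hx
      have h2 : Real.exp (-C * t) * u x t ≤ C := by
        have he : Real.exp (-C * t) ≤ 1 := Real.exp_le_one_iff.2 (by nlinarith [ht.1])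
        calc Real.exp (-C * t) * u x t ≤ Real.exp (-C * t) * C :=
              mul_le_mul_of_nonneg_left ((le_abs_self _).trans (hbound x t ht)) (Real.exp_nonneg _)
          _ ≤ 1 * C := mul_le_mul_of_nonneg_right he hC.le
          _ = C := one_mul C
      have h3 : -(|A + 1| * T) ≤ (A + 1) * t := by
        have h4 : |(A + 1) * t| ≤ |A + 1| * T := by
          rw [abs_mul, abs_of_nonneg ht.1]
          exact mul_le_mul_of_nonneg_left ht.2 (abs_nonneg _)
        linarith [neg_abs_le ((A + 1) * t)]
      have h5 : C < ε * (f x + (A + 1) * t) := by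
        rw [mul_comm, ← div_lt_iff₀ hε]
        linarith
      simp only [v]
      linarith
    have hx₁ : x₁ ∈ K := by
      by_contra h
      exact absurd (hout x₁ h t₁ ht₁) (not_le.2 hv₁)
    have hvcont : ContinuousOn (fun p : M × ℝ => v p.1 p.2) (K ×ˢ Icc 0 T) := by
      have h1 : ContinuousOn (fun p : M × ℝ => u p.1 p.2) (K ×ˢ Icc 0 T) :=
        hu.continuousOn.mono (prod_mono_left (subset_univ K))
      have h2 : Continuous fun p : M × ℝ => f p.1 := hf.continuous.comp continuous_fst
      have h3 : Continuous fun p : M × ℝ => Real.exp (-C * p.2) := by fun_prop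
      have h4 : Continuous fun p : M × ℝ => ε * (A + 1) * p.2 := by fun_prop
      exact ((h3.continuousOn.mul h1).sub (h2.const_mul ε).continuousOn).sub h4.continuousOn
    obtain ⟨⟨x₀, t₀⟩, ⟨hx₀, ht₀⟩, hmax⟩ :=
      (hK.prod isCompact_Icc).exists_isMaxOn ⟨(x₁, t₁), hx₁, ht₁⟩ hvcont
    have hv₀ : 0 < v x₀ t₀ := hv₁.trans_le (hmax (mk_mem_prod hx₁ ht₁))
    have ht₀pos : 0 < t₀ := by
      refine lt_of_le_of_ne ht₀.1 fun h => ?_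
      subst h
      have h1 := hinit x₀
      have h2 := mul_pos hε (hfpos x₀)
      simp only [v, mul_zero, Real.exp_zero, one_mul] at hv₀
      linarith
    have hupos : 0 < u x₀ t₀ := by
      -- A bound for a norm is nonnegative, so both subtracted terms of `v` are nonnegative and `v >
      -- 0` forces `u > 0`.
      have hA0 : 0 ≤ A := (Real.sqrt_nonneg _).trans (hgrad x₀)
      have h1 := mul_pos hε (hfpos x₀)
      have h2 : 0 ≤ ε * (A + 1) * t₀ := by positivity
      simp only [v] at hv₀
      exact pos_of_mul_pos_right (by linarith : 0 < Real.exp (-C * t₀) * u x₀ t₀)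
        (Real.exp_nonneg _)
    have hspace : Real.exp (-C * t₀) * Lu x₀ t₀ + (-ε) * Lf x₀ ≤ 0 := by
      refine (hLu t₀ ht₀).combination_nonpos_of_isLocalMax (hslice t₀ ht₀)
        (hf.of_le (by norm_cast)) hLf _ _ (Eventually.of_forall fun x => ?_)
      -- The maximum over `K` is one over all of `M`, since off `K` one has `v ≤ 0 < v x₀ t₀`; so
      -- `x₀` is a local maximum even on the boundary of `K`.
      have h : v x t₀ ≤ v x₀ t₀ := by
        by_cases hx : x ∈ K
        · exact hmax (mk_mem_prod hx ht₀)
        · exact (hout x hx t₀ ht₀).trans hv₀.le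
      simp only [v] at h
      linarith
    have htime : HasDerivWithinAt (v x₀) (Real.exp (-C * t₀) * (-C * 1) * u x₀ t₀ +
        Real.exp (-C * t₀) * (Lu x₀ t₀ + F x₀ (differential n (fun y => u y t₀) x₀) (u x₀ t₀) t₀) -
        ε * (A + 1) * 1) (Icc 0 T) t₀ :=
      (((((hasDerivAt_id t₀).const_mul (-C)).exp.hasDerivWithinAt.mul (hevol x₀ t₀ ht₀)).sub_const
        (ε * f x₀))).sub ((hasDerivAt_id t₀).const_mul (ε * (A + 1))).hasDerivWithinAt
    have hnonneg := hasDerivWithinAt_nonneg_of_isMaxOn ht₀ ht₀pos htime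
      fun t ht => hmax (mk_mem_prod hx₀ ht)
    have hFle := mul_le_mul_of_nonneg_left (hF x₀ t₀ ht₀ hupos) (Real.exp_nonneg (-C * t₀))
    have hLle := mul_le_mul_of_nonneg_left (hLfA x₀) hε.le
    -- The inequalities add up to `0 ≤ ε A - ε (A + 1) = -ε`.
    nlinarith
  intro x t ht
  by_contra! hpos
  set k := f x + (A + 1) * t
  have hw : 0 < Real.exp (-C * t) * u x t := mul_pos (Real.exp_pos _) hpos
  set w := Real.exp (-C * t) * u x t
  have hk : 0 < |k| + 1 := by positivity
  -- The limit `ε → 0` is replaced by one value of `ε`, small enough that `ε k ≤ w / 2`, which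
  -- contradicts `w ≤ ε k`.
  have h := main (w / (2 * (|k| + 1))) (by positivity) x t ht
  have h1 : w ≤ w / (2 * (|k| + 1)) * k := by simp only [k]; linarith
  have h2 : w / (2 * (|k| + 1)) * k ≤ w / (2 * (|k| + 1)) * (|k| + 1) :=
    mul_le_mul_of_nonneg_left (by linarith [le_abs_self k]) (by positivity)
  have h3 : w / (2 * (|k| + 1)) * (|k| + 1) = w / 2 := by field_simp
  linarith
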